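/- Theorem 3.2. Let $(R,\mathfrak m)$ be a commutative Noetherian local ring, let $\mathfrak a$ be an ideal of $R$ which is principal up to radical, i.e. $\sqrt{\mathfrak a}=\sqrt{xR}$ for some $x\in R$, and let $M$ be a finitely generated $R$-module. For $i\ge 0$ let $$\mathfrak F^i_{\mathfrak a}(M):=\varprojlim_n H^i_{\mathfrak m}(M/\mathfrak a^nM)$$ be the $i$-th formal local cohomology module of $M$ with respect to $\mathfrak a$, where $H^i_{\mathfrak m}(-)=\varinjlim_k \operatorname{Ext}^i_R(R/\mathfrak m^k,-)$ is local cohomology with support in $\mathfrak m$ and the limit is taken along the maps induced by the projections $M/\mathfrak a^{n+1}M\to M/\mathfrak a^nM$. Then the $R$-module $\operatorname{Tor}_j^R(R/\mathfrak a,\mathfrak F^i_{\mathfrak a}(M))$ is Artinian for all $i\ge 0$ and $j\ge 0$. -/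

import Mathlib

open CategoryTheory Limits

universe u

noncomputable section

/-- An ideal is principal up to radical if it has the same radical as some principal ideal. -/
def Ideal.IsPrincipalUpToRadical {R : Type u} [CommRing R] (a : Ideal R) : Prop :=
  ∃ x : R, a.radical = (Ideal.span {x}).radical

namespace FormalLocalCohomology

/-- The inverse system `⋯ ⟶ M / a ^ (n + 1) M ⟶ M / a ^ n M ⟶ ⋯ ⟶ M / a M ⟶ M / M = 0` of
`R`-modules, whose transition maps are the natural projections. -/
def quotientTower {R : Type u} [CommRing R] (a : Ideal R) (M : ModuleCat.{u} R) :
    ℕᵒᵖ ⥤ ModuleCat.{u} R where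
  obj n := ModuleCat.of R (M ⧸ (a ^ n.unop • ⊤ : Submodule R M))
  map f := ModuleCat.ofHom
    (Submodule.factor (Submodule.smul_mono_left (Ideal.pow_le_pow_right f.unop.le)))
  map_id n := by
    ext x
    rfl
  map_comp f g := by
    ext x
    rfl

end FormalLocalCohomology

/-- The `i`-th formal local cohomology module `lim_n H^i_m(M / a ^ n M)` of a module `M` over a
local ring `(R, m)` with respect to an ideal `a`. -/
def formalLocalCohomology {R : Type u} [CommRing R] [IsLocalRing R] (a : Ideal R)
    (i : ℕ) (M : ModuleCat.{u} R) : ModuleCat.{u} R :=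
  limit (FormalLocalCohomology.quotientTower a M ⋙
    localCohomology (IsLocalRing.maximalIdeal R) i)

/-- `Tor_j^R(N, X)`, computed as `H_j(P ⊗ X)` for a projective resolution `P` of `N`. -/
abbrev torModule {R : Type u} [CommRing R] (j : ℕ) (N X : ModuleCat.{u} R) : ModuleCat.{u} R :=
  ((Tor' (ModuleCat.{u} R) j).obj N).obj X

end

/-! Some power `y` of `x` lies in `a`, and `a ^ c ≤ (y)` for some `c`, so the `a`-adic and `y`-adic
filtrations of any module are cofinal and define the same limit of local cohomology. Since `M` is
Noetherian, `y` is injective on `N = y ^ s M` for `s` large; give `N` the filtration `W n = y ^ n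
N`.

An injection `f : N → M'` of finite modules yields exact sequences `0 → N / W n → M' / f (W n) → M'
/ f N → 0` whose last term does not depend on `n`. Local cohomology of finite modules at the maximal
ideal is Artinian, and sequential limits are exact on Artinian towers (Mittag-Leffler). So the map
of limits has kernel a quotient of `H^(i-1)(M' / f N)` (zero for `i = 0`) and cokernel a submodule
of `H^i(M' / f N)`, both Artinian.

For `f = y : N → N` the target filtration `y W n` is cofinal with `W n`, so multiplication by `y` on
`F = lim H^i(N / W n)` has Artinian kernel and cokernel. As `y` kills `R / a`, it acts as zero on
`Tor_j(R / a, F)`; factoring it as `F → y F → F` and using the long exact sequences puts `Tor_j(R /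
a, F)` between Artinian modules (`ModuleCat.hasArtinianTor_of_smul`). For `f` the inclusion `N → M`,
the Artinian kernel and cokernel transfer the conclusion to the formal local cohomology of `M`
(`ModuleCat.HasArtinianTor.of_linearMap`).

The background proved on the way: the long exact sequence of local cohomology, obtained from Ext by
filtered colimits; its Artinianness (`localCohomology.hasArtinianLocalCohomology`), resting on a
torsion criterion (`isArtinian_of_isArtinian_ker_lsmul`); and exactness of limits
(`ModuleCat.exact_limMap`). -/

noncomputable section

/-! ### Cohomology of `Hom(P, Y)` and the derived-category Ext groups. -/

namespace CategoryTheory.ProjectiveResolution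

universe v

variable {C : Type u} [Category.{v} C] [Abelian C]

variable (R : Type v) [Ring R] [Linear R C] {X Y : C} (P : ProjectiveResolution X) (n : ℕ)

/-- The cocycle underlying a cycle of the complex `Hom(P, Y)`. -/
def cocycle (z : (P.complex.linearYonedaObj R Y).cycles n) : P.complex.X n ⟶ Y :=
  (P.complex.linearYonedaObj R Y).iCycles n z

lemma d_comp_cocycle (z : (P.complex.linearYonedaObj R Y).cycles n) :
    P.complex.d (n + 1) n ≫ P.cocycle R n z = 0 :=
  congr($((P.complex.linearYonedaObj R Y).iCycles_d n (n + 1)) z)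

lemma cocycle_add (z w : (P.complex.linearYonedaObj R Y).cycles n) :
    P.cocycle R n (z + w) = P.cocycle R n z + P.cocycle R n w :=
  map_add ((P.complex.linearYonedaObj R Y).iCycles n).hom z w

lemma cocycle_smul (r : R) (z : (P.complex.linearYonedaObj R Y).cycles n) :
    P.cocycle R n (r • z) = r • P.cocycle R n z :=
  map_smul ((P.complex.linearYonedaObj R Y).iCycles n).hom r z

lemma cocycle_injective : Function.Injective (P.cocycle R n (Y := Y)) :=
  (ModuleCat.mono_iff_injective ((P.complex.linearYonedaObj R Y).iCycles n)).1 inferInstance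

lemma cocycle_toCycles (i : ℕ) (g : P.complex.X i ⟶ Y) :
    P.cocycle R n ((P.complex.linearYonedaObj R Y).toCycles i n g) = P.complex.d n i ≫ g :=
  congr($((P.complex.linearYonedaObj R Y).toCycles_i i n) g)

lemma exists_cocycle_eq (f : P.complex.X n ⟶ Y) (hf : P.complex.d (n + 1) n ≫ f = 0) :
    ∃ z, P.cocycle R n z = f := by
  let l : ModuleCat.of R R ⟶ (P.complex.linearYonedaObj R Y).X n :=
    ModuleCat.ofHom (LinearMap.toSpanSingleton R (P.complex.X n ⟶ Y) f)
  have hl : l ≫ (P.complex.linearYonedaObj R Y).d n (n + 1) = 0 := by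
    ext
    change P.complex.d (n + 1) n ≫ ((1 : R) • f) = 0
    simp [hf]
  refine ⟨(P.complex.linearYonedaObj R Y).liftCycles l (n + 1) (by simp) hl (1 : R), ?_⟩
  refine (congr($((P.complex.linearYonedaObj R Y).liftCycles_i l (n + 1) (by simp) hl)
    (1 : R))).trans ?_
  exact one_smul R f

lemma homologyπ_surjective :
    Function.Surjective ((P.complex.linearYonedaObj R Y).homologyπ n) :=
  (ModuleCat.epi_iff_surjective _).1 inferInstance

lemma cocycle_cyclesMap {X' Y' : C} {P : ProjectiveResolution X} {P' : ProjectiveResolution X'}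
    (φ : P.complex.linearYonedaObj R Y ⟶ P'.complex.linearYonedaObj R Y')
    (z : (P.complex.linearYonedaObj R Y).cycles n) :
    P'.cocycle R n (HomologicalComplex.cyclesMap φ n z) = φ.f n (P.cocycle R n z) :=
  congr($(HomologicalComplex.cyclesMap_i φ n) z)

variable [HasExt.{v} C]

open CochainComplex HomComplex in
-- Degree 0 is separate from `extMk_eq_zero_iff`: a coboundary would factor through cohomological
-- degree 1 of the resolution, which is zero.
lemma eq_zero_of_extMk_zero_eq_zero (f : P.complex.X 0 ⟶ Y) (hf : P.complex.d 1 0 ≫ f = 0)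
    (h : P.extMk f 1 rfl hf = 0) : f = 0 := by
  rw [← P.extEquivCohomologyClass.apply_eq_iff_eq, extEquivCohomologyClass_extMk,
    extEquivCohomologyClass_zero, CohomologyClass.mk_eq_zero_iff] at h
  rw [Cocycle.toSingleMk_mem_coboundaries_iff _ _ _ _ _ 1 (by lia)] at h
  obtain ⟨g, hg⟩ := h
  have hz : g = 0 := (CochainComplex.isZero_of_isStrictlyLE P.cochainComplex 0 1).eq_of_src _ _
  rw [← cancel_epi (P.cochainComplexXIso (-(0 : ℕ)) 0 rfl).hom]
  subst hz
  simpa using hg.symm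

lemma smul_extMk (r : R) (f : P.complex.X n ⟶ Y) (m : ℕ) (hm : n + 1 = m)
    (hf : P.complex.d m n ≫ f = 0) :
    r • P.extMk f m hm hf = P.extMk (r • f) m hm (by simp [hf]) := by
  rw [Abelian.Ext.smul_eq_comp_mk₀, extMk_comp_mk₀]
  simp

/-- The class in `Ext X Y n` of a cocycle of the complex `Hom(P, Y)`. -/
def cyclesToExt : (P.complex.linearYonedaObj R Y).cycles n →ₗ[R] Abelian.Ext.{v} X Y n where
  toFun z := P.extMk _ (n + 1) rfl (P.d_comp_cocycle R n z)
  map_add' z w := by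
    rw [add_extMk]
    simp only [cocycle_add]
  map_smul' r z := by
    rw [RingHom.id_apply, smul_extMk]
    simp only [cocycle_smul]

lemma cyclesToExt_apply (z : (P.complex.linearYonedaObj R Y).cycles n) :
    P.cyclesToExt R n z = P.extMk _ (n + 1) rfl (P.d_comp_cocycle R n z) :=
  rfl

lemma cyclesToExt_surjective : Function.Surjective (P.cyclesToExt R n (Y := Y)) := by
  intro e
  obtain ⟨f, hf, rfl⟩ := P.extMk_surjective e (n + 1) rfl
  obtain ⟨z, rfl⟩ := P.exists_cocycle_eq R n f hf
  exact ⟨z, rfl⟩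

/-- The index `i` is arbitrary because it is used with `i = n - 1`; for `n = 0` this is again `0`,
and the differential from `0` to `0` vanishes. -/
lemma cyclesToExt_toCycles (i : ℕ) (g : P.complex.X i ⟶ Y) :
    P.cyclesToExt R n ((P.complex.linearYonedaObj R Y).toCycles i n g) = 0 := by
  rw [cyclesToExt_apply]
  simp only [cocycle_toCycles]
  by_cases h : i + 1 = n
  · exact (P.extMk_eq_zero_iff _ _ _ _ i h).2 ⟨g, rfl⟩
  · have h0 : P.complex.d n i = 0 := P.complex.shape _ _ (by simpa using h)
    simp [h0]

lemma exists_toCycles_of_cyclesToExt_eq_zero (z : (P.complex.linearYonedaObj R Y).cycles n)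
    (hz : P.cyclesToExt R n z = 0) :
    ∃ g, (P.complex.linearYonedaObj R Y).toCycles (n - 1) n g = z := by
  rw [cyclesToExt_apply] at hz
  obtain _ | n := n
  · refine ⟨(0 : P.complex.X 0 ⟶ Y), P.cocycle_injective R 0 ?_⟩
    rw [P.eq_zero_of_extMk_zero_eq_zero _ _ hz]
    exact (P.cocycle_toCycles R 0 0 0).trans (by simp)
  · obtain ⟨g, hg⟩ := (P.extMk_eq_zero_iff _ _ _ _ n rfl).1 hz
    refine ⟨g, P.cocycle_injective R (n + 1) ?_⟩
    rw [← hg]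
    exact P.cocycle_toCycles R (n + 1) n g

/-- The map from the cohomology of the complex `Hom(P, Y)` to `Ext X Y n`. -/
def homologyToExt :
    (P.complex.linearYonedaObj R Y).homology n ⟶ ModuleCat.of R (Abelian.Ext.{v} X Y n) :=
  ((P.complex.linearYonedaObj R Y).homologyIsCokernel (n - 1) n (by cases n <;> simp)).desc
    (CokernelCofork.ofπ (ModuleCat.ofHom (P.cyclesToExt R n)) (by
      ext g
      exact P.cyclesToExt_toCycles R n (n - 1) g))

lemma homologyπ_homologyToExt :
    (P.complex.linearYonedaObj R Y).homologyπ n ≫ P.homologyToExt R n =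
      ModuleCat.ofHom (P.cyclesToExt R n) :=
  ((P.complex.linearYonedaObj R Y).homologyIsCokernel (n - 1) n (by cases n <;> simp)).fac _
    WalkingParallelPair.one

lemma homologyToExt_homologyπ (z : (P.complex.linearYonedaObj R Y).cycles n) :
    P.homologyToExt R n ((P.complex.linearYonedaObj R Y).homologyπ n z) = P.cyclesToExt R n z :=
  congr($(P.homologyπ_homologyToExt R n) z)

lemma homologyToExt_bijective : Function.Bijective (P.homologyToExt R n (Y := Y)) := by
  constructor
  · rw [injective_iff_map_eq_zero]
    intro a ha
    obtain ⟨z, rfl⟩ := P.homologyπ_surjective R n a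
    rw [homologyToExt_homologyπ] at ha
    obtain ⟨g, rfl⟩ := P.exists_toCycles_of_cyclesToExt_eq_zero R n z ha
    exact congr($((P.complex.linearYonedaObj R Y).toCycles_comp_homologyπ (n - 1) n) g)
  · intro e
    obtain ⟨z, rfl⟩ := P.cyclesToExt_surjective R n e
    exact ⟨_, P.homologyToExt_homologyπ R n z⟩

lemma homologyToExt_homologyMap {X' Y' : C} {P : ProjectiveResolution X}
    {P' : ProjectiveResolution X'}
    (φ : P.complex.linearYonedaObj R Y ⟶ P'.complex.linearYonedaObj R Y')
    (z : (P.complex.linearYonedaObj R Y).cycles n) :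
    P'.homologyToExt R n (HomologicalComplex.homologyMap φ n
      ((P.complex.linearYonedaObj R Y).homologyπ n z)) =
      P'.cyclesToExt R n (HomologicalComplex.cyclesMap φ n z) := by
  rw [← homologyToExt_homologyπ]
  exact congr(P'.homologyToExt R n ($(HomologicalComplex.homologyπ_naturality φ n) z))

lemma homologyToExt_homologyMap_right {Y' : C} (g : Y ⟶ Y')
    (φ : P.complex.linearYonedaObj R Y ⟶ P.complex.linearYonedaObj R Y')
    (hφ : ∀ f : P.complex.X n ⟶ Y, φ.f n f = f ≫ g)
    (a : (P.complex.linearYonedaObj R Y).homology n) :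
    P.homologyToExt R n (HomologicalComplex.homologyMap φ n a) =
      (P.homologyToExt R n a : Abelian.Ext.{v} X Y n).comp (Abelian.Ext.mk₀ g) (add_zero n) := by
  obtain ⟨z, rfl⟩ := P.homologyπ_surjective R n a
  rw [homologyToExt_homologyMap, homologyToExt_homologyπ, cyclesToExt_apply,
    cyclesToExt_apply, extMk_comp_mk₀]
  simp only [cocycle_cyclesMap, hφ]

lemma homologyToExt_homologyMap_left {X' : C} {g : X' ⟶ X} (P' : ProjectiveResolution X')
    (ψ : Hom P' P g) (φ : P.complex.linearYonedaObj R Y ⟶ P'.complex.linearYonedaObj R Y)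
    (hφ : ∀ f : P.complex.X n ⟶ Y, φ.f n f = ψ.hom.f n ≫ f)
    (a : (P.complex.linearYonedaObj R Y).homology n) :
    P'.homologyToExt R n (HomologicalComplex.homologyMap φ n a) =
      (Abelian.Ext.mk₀ g).comp (P.homologyToExt R n a : Abelian.Ext.{v} X Y n) (zero_add n) := by
  obtain ⟨z, rfl⟩ := P.homologyπ_surjective R n a
  rw [homologyToExt_homologyMap, homologyToExt_homologyπ, cyclesToExt_apply,
    cyclesToExt_apply, mk₀_comp_extMk (φ := ψ)]
  simp only [cocycle_cyclesMap, hφ]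

end CategoryTheory.ProjectiveResolution

/-! ### Naturality of `ProjectiveResolution.isoExt` in both variables. -/

namespace CategoryTheory

variable {C : Type*} [Category* C]

lemma comp_inv_eq_inv_comp_of_comp_hom_eq {A A' B B' : C} {α : A ≅ A'} {β : B ≅ B'} {f : A ⟶ B}
    {g : A' ⟶ B'} (h : f ≫ β.hom = α.hom ≫ g) : g ≫ β.inv = α.inv ≫ f := by
  rw [Iso.comp_inv_eq, Category.assoc, h, Iso.inv_hom_id_assoc]

lemma comp_comp_eq_of_comp_eq_of_comp_eq {X₁ X₂ X₃ Y₁ Y₂ Y₃ : C} {f₁ : X₁ ⟶ X₂} {f₂ : X₂ ⟶ X₃}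
    {g₁ : Y₁ ⟶ Y₂} {g₂ : Y₂ ⟶ Y₃} {a : X₁ ⟶ Y₁} {b : X₂ ⟶ Y₂} {c : X₃ ⟶ Y₃}
    (h₁ : a ≫ g₁ = f₁ ≫ b) (h₂ : b ≫ g₂ = f₂ ≫ c) :
    a ≫ (g₁ ≫ g₂) = (f₁ ≫ f₂) ≫ c := by
  rw [reassoc_of% h₁, h₂, Category.assoc]

end CategoryTheory

namespace HomologicalComplex

variable {ι V : Type*} [Category* V] {c : ComplexShape ι} [HasZeroMorphisms V]

/-- The functor `Ext` is a left derived functor with values in an opposite category, so its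
identification with cohomology passes through `homologyUnop`. -/
lemma homologyMap_unop_homologyUnop_inv {K L : HomologicalComplex Vᵒᵖ c} (φ : K ⟶ L) (i : ι)
    [K.HasHomology i] [L.HasHomology i] :
    (homologyMap φ i).unop ≫ (K.homologyUnop i).inv =
      (L.homologyUnop i).inv ≫
        (show L.unop.homology i ⟶ K.unop.homology i from
          homologyMap ((unopFunctor V c).map φ.op) i) :=
  comp_inv_eq_inv_comp_of_comp_hom_eq
    congr($(homologyOp_hom_naturality (K := L.unop) (L := K.unop)
      ((unopFunctor V c).map φ.op) i).unop).symm

end HomologicalComplex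

namespace CategoryTheory.ProjectiveResolution

universe v

variable {C : Type u} [Category.{v} C] [Abelian C] [EnoughProjectives C]
  (R : Type v) [Ring R] [Linear R C] {X Y : C} (P : ProjectiveResolution X) (n : ℕ)

/-- The map of complexes `Hom(P, Y) ⟶ Hom(P', Y)` induced by a map of complexes `P' ⟶ P`. -/
def linearYonedaObjMapLeft {K K' : ChainComplex C ℕ} (ψ : K' ⟶ K) (Y : C) :
    K.linearYonedaObj R Y ⟶ K'.linearYonedaObj R Y :=
  (HomologicalComplex.unopFunctor _ _).map
    ((((linearYoneda R C).obj Y).rightOp.mapHomologicalComplex _).map ψ).op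

/-- The map of complexes `Hom(P, Y) ⟶ Hom(P, Y')` induced by a morphism `Y ⟶ Y'`. -/
def linearYonedaObjMapRight (K : ChainComplex C ℕ) {Y Y' : C} (g : Y ⟶ Y') :
    K.linearYonedaObj R Y ⟶ K.linearYonedaObj R Y' :=
  (HomologicalComplex.unopFunctor _ _).map
    ((NatTrans.mapHomologicalComplex (NatTrans.rightOp ((linearYoneda R C).map g)) _).app K).op

lemma map_isoExt_hom_left {X' : C} {g : X' ⟶ X} (P' : ProjectiveResolution X')
    (ψ : Hom P' P g) :
    ((Ext R C n).map g.op).app Y ≫ (P'.isoExt n Y).hom =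
      (P.isoExt n Y).hom ≫ HomologicalComplex.homologyMap
        (linearYonedaObjMapLeft R ψ.hom Y) n := by
  have h := congr($(isoLeftDerivedObj_inv_naturality g P' P ψ.hom
    (by simpa using ψ.hom_f_zero_comp_π_f_zero) ((linearYoneda R C).obj Y).rightOp n).unop)
  have h2 := HomologicalComplex.homologyMap_unop_homologyUnop_inv
    ((((linearYoneda R C).obj Y).rightOp.mapHomologicalComplex (.down ℕ)).map ψ.hom) n
  exact comp_comp_eq_of_comp_eq_of_comp_eq h h2

lemma map_isoExt_hom_right {Y' : C} (g : Y ⟶ Y') :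
    ((Ext R C n).obj (.op X)).map g ≫ (P.isoExt n Y').hom =
      (P.isoExt n Y).hom ≫ HomologicalComplex.homologyMap
        (linearYonedaObjMapRight R P.complex g) n := by
  have h := P.leftDerived_app_eq (NatTrans.rightOp ((linearYoneda R C).map g)) n
  rw [← Category.assoc, Iso.eq_comp_inv] at h
  have h1 := congr($(comp_inv_eq_inv_comp_of_comp_hom_eq h).unop).symm
  have h2 := HomologicalComplex.homologyMap_unop_homologyUnop_inv
    ((NatTrans.mapHomologicalComplex (NatTrans.rightOp ((linearYoneda R C).map g)) (.down ℕ)).app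
          P.complex) n
  exact comp_comp_eq_of_comp_eq_of_comp_eq h1 h2

end CategoryTheory.ProjectiveResolution

/-! ### The two versions of Ext agree, naturally. -/

namespace CategoryTheory.Abelian

universe v

variable {C : Type u} [Category.{v} C] [Abelian C] [EnoughProjectives C] [HasExt.{v} C]
  (R : Type v) [CommRing R] [Linear R C]

/-- The functor `Ext R C n`, defined through projective resolutions, agrees with the `Ext`-groups
defined through the derived category. -/
def derivedExtEquiv (X Y : C) (n : ℕ) :
    ((_root_.Ext R C n).obj (.op X)).obj Y ≃ₗ[R] Ext.{v} X Y n :=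
  ((projectiveResolution X).isoExt n Y).toLinearEquiv ≪≫ₗ
    LinearEquiv.ofBijective ((projectiveResolution X).homologyToExt R n).hom
      ((projectiveResolution X).homologyToExt_bijective R n)

lemma derivedExtEquiv_map_left {X X' : C} (g : X' ⟶ X) (Y : C) (n : ℕ)
    (a : ((_root_.Ext R C n).obj (.op X)).obj Y) :
    derivedExtEquiv R X' Y n (((_root_.Ext R C n).map g.op).app Y a) =
      (Ext.mk₀ g).comp (derivedExtEquiv R X Y n a) (zero_add n) := by
  let ψ : ProjectiveResolution.Hom (projectiveResolution X') (projectiveResolution X) g :=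
    ⟨ProjectiveResolution.lift g _ _, by simpa using ProjectiveResolution.lift_commutes_zero g _ _⟩
  have h := congr($((projectiveResolution X).map_isoExt_hom_left R n
    (projectiveResolution X') ψ (Y := Y)) a)
  exact congr((projectiveResolution X').homologyToExt R n $h).trans
    ((projectiveResolution X).homologyToExt_homologyMap_left R n _ ψ _ (fun f ↦ rfl) _)

lemma derivedExtEquiv_map_right (X : C) {Y Y' : C} (g : Y ⟶ Y') (n : ℕ)
    (a : ((_root_.Ext R C n).obj (.op X)).obj Y) :
    derivedExtEquiv R X Y' n (((_root_.Ext R C n).obj (.op X)).map g a) =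
      (derivedExtEquiv R X Y n a).comp (Ext.mk₀ g) (add_zero n) := by
  have h := congr($((projectiveResolution X).map_isoExt_hom_right R n g) a)
  exact congr((projectiveResolution X).homologyToExt R n $h).trans
    ((projectiveResolution X).homologyToExt_homologyMap_right R n g _ (fun f ↦ rfl) _)

end CategoryTheory.Abelian

/-! ### Local cohomology as a filtered colimit of Ext modules. -/

namespace localCohomology

open Opposite Abelian

variable {R : Type u} [CommRing R] (J : Ideal R)

/-- The `R`-module `R / J ^ k`. -/
abbrev quotientPow (k : ℕ) : ModuleCat.{u} R := ModuleCat.of R (R ⧸ J ^ k)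

/-- The projection `R / J ^ l ⟶ R / J ^ k` for `k ≤ l`. -/
def quotientPowMap {k l : ℕ} (h : k ≤ l) : quotientPow J l ⟶ quotientPow J k :=
  (ringModIdeals (idealPowersDiagram J)).map (homOfLE h).op

/-- The canonical map from `Ext (R / J ^ k) M i` to the local cohomology module `H^i_J(M)`. -/
def fromExt (i k : ℕ) (M : ModuleCat.{u} R) :
    Ext.{u} (quotientPow J k) M i →ₗ[R] (localCohomology J i).obj M :=
  ((colimit.ι (diagram (idealPowersDiagram J) i) (op (op k))).app M).hom ∘ₗ
    (derivedExtEquiv R (quotientPow J k) M i).symm.toLinearMap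

variable (i : ℕ) (M : ModuleCat.{u} R)

lemma fromExt_derivedExtEquiv (k : ℕ)
    (a : ((_root_.Ext R (ModuleCat.{u} R) i).obj (op (quotientPow J k))).obj M) :
    fromExt J i k M (derivedExtEquiv R (quotientPow J k) M i a) =
      (colimit.ι (diagram (idealPowersDiagram J) i) (op (op k))).app M a :=
  congr((colimit.ι (diagram (idealPowersDiagram J) i) (op (op k))).app M
    $(LinearEquiv.symm_apply_apply _ a))

/-- Evaluating the colimit defining local cohomology at a module yields a colimit. -/
def isColimitEvaluation :
    IsColimit (((evaluation _ _).obj M).mapCocone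
      (colimit.cocone (diagram (idealPowersDiagram J) i))) :=
  isColimitOfPreserves _ (colimit.isColimit _)

instance : PreservesFilteredColimitsOfSize.{0, 0} (forget (ModuleCat.{u} R)) :=
  preservesFilteredColimitsOfSize_shrink.{0, u, 0, u} _

/-- With `fromExt_precomp` and `fromExt_eq_zero` this is the elementwise description of the filtered
colimit: classes come from some `R / J ^ k`, and vanish only by vanishing over some larger power. -/
lemma exists_fromExt_eq (z : (localCohomology J i).obj M) :
    ∃ k e, fromExt J i k M e = z := by
  obtain ⟨k, a, ha⟩ := Concrete.isColimit_exists_rep _ (isColimitEvaluation J i M) z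
  exact ⟨k.unop.unop, derivedExtEquiv R _ M i a, (fromExt_derivedExtEquiv J i M _ a).trans ha⟩

variable {M}

lemma fromExt_precomp {k l : ℕ} (h : k ≤ l) (e : Ext.{u} (quotientPow J k) M i) :
    fromExt J i l M ((Ext.mk₀ (quotientPowMap J h)).comp e (zero_add i)) = fromExt J i k M e := by
  obtain ⟨a, rfl⟩ := (derivedExtEquiv R _ M i).surjective e
  rw [← derivedExtEquiv_map_left, fromExt_derivedExtEquiv, fromExt_derivedExtEquiv]
  exact congr(NatTrans.app $(colimit.w (diagram (idealPowersDiagram J) i)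
    (homOfLE h).op.op) M a)

lemma fromExt_eq_zero {k : ℕ} {e : Ext.{u} (quotientPow J k) M i} (he : fromExt J i k M e = 0) :
    ∃ l, ∃ h : k ≤ l, (Ext.mk₀ (quotientPowMap J h)).comp e (zero_add i) = 0 := by
  obtain ⟨a, rfl⟩ := (derivedExtEquiv R _ M i).surjective e
  rw [fromExt_derivedExtEquiv] at he
  obtain ⟨l, f, g, hfg⟩ := Concrete.isColimit_exists_of_rep_eq _ (isColimitEvaluation J i M)
    (i := op (op k)) (j := op (op k)) a 0 (he.trans (map_zero _).symm)
  refine ⟨l.unop.unop, leOfHom f.unop.unop, ?_⟩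
  rw [← derivedExtEquiv_map_left, ← map_zero (derivedExtEquiv R _ M i)]
  refine congr(derivedExtEquiv R _ M i $(hfg.trans (map_zero _)))

lemma map_fromExt {M' : ModuleCat.{u} R} (g : M ⟶ M') {k : ℕ}
    (e : Ext.{u} (quotientPow J k) M i) :
    (localCohomology J i).map g (fromExt J i k M e) =
      fromExt J i k M' (e.comp (Ext.mk₀ g) (add_zero i)) := by
  obtain ⟨a, rfl⟩ := (derivedExtEquiv R _ M i).surjective e
  rw [← derivedExtEquiv_map_right, fromExt_derivedExtEquiv, fromExt_derivedExtEquiv]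
  exact congr($(((colimit.ι (diagram (idealPowersDiagram J) i) (op (op k))).naturality g)) a).symm

end localCohomology

/-! ### Linearity, torsion and the long exact sequence of local cohomology. -/

namespace localCohomology

open Opposite Abelian

variable {R : Type u} [CommRing R] (J : Ideal R) (i : ℕ) {M : ModuleCat.{u} R}

lemma map_smul_apply {M' : ModuleCat.{u} R} (r : R) (g : M ⟶ M') (z : (localCohomology J i).obj M) :
    (localCohomology J i).map (r • g) z = r • (localCohomology J i).map g z := by
  obtain ⟨k, e, rfl⟩ := exists_fromExt_eq J i M z
  rw [map_fromExt, map_fromExt, ← map_smul, Ext.mk₀_smul, Ext.comp_smul]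

lemma map_zero_apply {M' : ModuleCat.{u} R} (z : (localCohomology J i).obj M) :
    (localCohomology J i).map (0 : M ⟶ M') z = 0 := by
  simpa using map_smul_apply J i (0 : R) (0 : M ⟶ M') z

/-- Every element of a local cohomology module with support in `J` is killed by a power of `J`. -/
lemma exists_pow_smul_eq_zero (z : (localCohomology J i).obj M) :
    ∃ k : ℕ, ∀ r ∈ J ^ k, r • z = 0 := by
  obtain ⟨k, e, rfl⟩ := exists_fromExt_eq J i M z
  refine ⟨k, fun r hr ↦ ?_⟩
  -- The action of `r` on Ext can be computed on the first argument, where it is zero.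
  have h0 : r • 𝟙 (quotientPow J k) = 0 := by
    ext
    change r • (1 : R ⧸ J ^ k) = 0
    rw [Algebra.smul_def, mul_one]
    exact Ideal.Quotient.eq_zero_iff_mem.2 hr
  have h : (Ext.mk₀ (r • 𝟙 (quotientPow J k))).comp e (zero_add i) = r • e := by
    rw [Ext.mk₀_smul, Ext.smul_comp, Ext.mk₀_id_comp]
  rw [← map_smul, ← h, h0, Ext.mk₀_zero, Ext.zero_comp, map_zero]

section Desc

variable {J i} {N : Type u} [AddCommGroup N] [Module R N]
  (g : ∀ k, Ext.{u} (quotientPow J k) M i →ₗ[R] N)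
  (hg : ∀ ⦃k l⦄ (h : k ≤ l) (e), g l ((Ext.mk₀ (quotientPowMap J h)).comp e (zero_add i)) = g k e)

/-- The cocone given by a compatible family of linear maps out of `Ext`-modules. -/
def descCocone :
    Cocone (diagram (idealPowersDiagram J) i ⋙ (evaluation _ (ModuleCat.{u} R)).obj M) where
  pt := ModuleCat.of R N
  ι :=
    { app k := ModuleCat.ofHom (g k.unop.unop ∘ₗ (derivedExtEquiv R _ M i).toLinearMap)
      naturality k l f := by
        ext a
        exact (congr(g l.unop.unop $(derivedExtEquiv_map_left R
          (quotientPowMap J (leOfHom f.unop.unop)) M i a))).trans (hg (leOfHom f.unop.unop) _) }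

/-- The linear map out of a local cohomology module given by a compatible family of linear maps
out of `Ext`-modules. -/
def desc : (localCohomology J i).obj M →ₗ[R] N :=
  ((isColimitEvaluation J i M).desc (descCocone g hg)).hom

lemma desc_fromExt {k : ℕ} (e : Ext.{u} (quotientPow J k) M i) :
    desc g hg (fromExt J i k M e) = g k e := by
  obtain ⟨a, rfl⟩ := (derivedExtEquiv R _ M i).surjective e
  rw [fromExt_derivedExtEquiv]
  exact congr($((isColimitEvaluation J i M).fac (descCocone g hg) (op (op k))) a)

end Desc

section LongExactSequence

variable {S : ShortComplex (ModuleCat.{u} R)} (hS : S.ShortExact)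

/-- The connecting homomorphism of the long exact sequence of local cohomology. -/
def δ : (localCohomology J i).obj S.X₃ →ₗ[R] (localCohomology J (i + 1)).obj S.X₁ :=
  desc (fun k ↦ fromExt J (i + 1) k S.X₁ ∘ₗ
    Ext.postcompOfLinear hS.extClass R (quotientPow J k) rfl) (by
      intro k l h e
      simp only [LinearMap.comp_apply, LinearMap.flip_apply, Ext.bilinearCompOfLinear_apply_apply]
      rw [Ext.comp_assoc _ _ _ (zero_add i) rfl (by lia), fromExt_precomp])

lemma δ_fromExt {k : ℕ} (e : Ext.{u} (quotientPow J k) S.X₃ i) :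
    δ J i hS (fromExt J i k S.X₃ e) = fromExt J (i + 1) k S.X₁ (e.comp hS.extClass rfl) :=
  desc_fromExt _ _ e

lemma map_δ {S' : ShortComplex (ModuleCat.{u} R)} (hS' : S'.ShortExact) (φ : S ⟶ S')
    (z : (localCohomology J i).obj S.X₃) :
    (localCohomology J (i + 1)).map φ.τ₁ (δ J i hS z) =
      δ J i hS' ((localCohomology J i).map φ.τ₃ z) := by
  obtain ⟨k, e, rfl⟩ := exists_fromExt_eq J i _ z
  rw [δ_fromExt, map_fromExt, map_fromExt, δ_fromExt,
    Ext.comp_assoc _ _ _ rfl (add_zero 1) (by lia),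
    ShortComplex.ShortExact.extClass_naturality hS hS' φ,
    Ext.comp_assoc _ _ _ (add_zero i) (zero_add 1) (by lia)]

include hS in
-- Exactness of filtered colimits: the relation already holds after restricting to some `R / J ^ l`,
-- where the exact sequence of Ext applies. The next two exactness lemmas follow the same pattern.
lemma exact_map_map :
    Function.Exact ((localCohomology J i).map S.f) ((localCohomology J i).map S.g) := by
  intro z
  constructor
  · intro hz
    obtain ⟨k, e, rfl⟩ := exists_fromExt_eq J i _ z
    rw [map_fromExt] at hz
    obtain ⟨l, h, hl⟩ := fromExt_eq_zero J i hz
    rw [← Ext.comp_assoc _ _ _ (zero_add i) (add_zero i) (by lia)] at hl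
    obtain ⟨e', he'⟩ := Ext.covariant_sequence_exact₂ _ hS _ hl
    refine ⟨fromExt J i l _ e', ?_⟩
    rw [map_fromExt, he', fromExt_precomp]
  · rintro ⟨z, rfl⟩
    have h := congr($((localCohomology J i).map_comp S.f S.g) z)
    rw [S.zero] at h
    exact h.symm.trans (map_zero_apply J i z)

lemma exact_map_δ : Function.Exact ((localCohomology J i).map S.g) (δ J i hS) := by
  intro z
  constructor
  · intro hz
    obtain ⟨k, e, rfl⟩ := exists_fromExt_eq J i _ z
    rw [δ_fromExt] at hz
    obtain ⟨l, h, hl⟩ := fromExt_eq_zero J _ hz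
    rw [← Ext.comp_assoc _ _ _ (zero_add i) rfl (by lia)] at hl
    obtain ⟨e', he'⟩ := Ext.covariant_sequence_exact₃ _ hS _ rfl hl
    refine ⟨fromExt J i l _ e', ?_⟩
    rw [map_fromExt, he', fromExt_precomp]
  · rintro ⟨z, rfl⟩
    obtain ⟨k, e, rfl⟩ := exists_fromExt_eq J i _ z
    rw [map_fromExt, δ_fromExt, Ext.comp_assoc _ _ _ (add_zero i) (zero_add 1) (by lia),
      hS.comp_extClass, Ext.comp_zero, map_zero]

lemma exact_δ_map : Function.Exact (δ J i hS) ((localCohomology J (i + 1)).map S.f) := by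
  intro z
  constructor
  · intro hz
    obtain ⟨k, e, rfl⟩ := exists_fromExt_eq J _ _ z
    rw [map_fromExt] at hz
    obtain ⟨l, h, hl⟩ := fromExt_eq_zero J _ hz
    rw [← Ext.comp_assoc _ _ _ (zero_add _) (add_zero _) (by lia)] at hl
    obtain ⟨e', he'⟩ := Ext.covariant_sequence_exact₁ _ hS _ hl rfl
    refine ⟨fromExt J i l _ e', ?_⟩
    rw [δ_fromExt, he', fromExt_precomp]
  · rintro ⟨z, rfl⟩
    obtain ⟨k, e, rfl⟩ := exists_fromExt_eq J i _ z
    rw [δ_fromExt, map_fromExt, Ext.comp_assoc _ _ _ rfl (add_zero 1) (by lia),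
      hS.extClass_comp, Ext.comp_zero, map_zero]

include hS in
lemma map_injective_zero : Function.Injective ((localCohomology J 0).map S.f) := by
  rw [injective_iff_map_eq_zero]
  intro z hz
  have := hS.mono_f
  obtain ⟨k, e, rfl⟩ := exists_fromExt_eq J _ _ z
  rw [map_fromExt] at hz
  obtain ⟨l, h, hl⟩ := fromExt_eq_zero J _ hz
  rw [← Ext.comp_assoc _ _ _ (zero_add _) (add_zero _) (by lia)] at hl
  have h0 : (Ext.mk₀ (quotientPowMap J h)).comp e (zero_add 0) = 0 :=
    Ext.postcomp_mk₀_injective_of_mono _ S.f (hl.trans (by simp))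
  rw [← fromExt_precomp J 0 h, h0, map_zero]

end LongExactSequence

end localCohomology

/-! ### An Artinianness criterion for torsion modules. -/

section Artinian

variable {R X : Type*} [CommRing R] [AddCommGroup X] [Module R X]

/-- The submodule `x ^ n (N ∩ (0 : x ^ (n + 1)))`. -/
def Submodule.socleLayer (x : R) (N : Submodule R X) (n : ℕ) : Submodule R X :=
  (N ⊓ LinearMap.ker (LinearMap.lsmul R X (x ^ (n + 1)))).map (LinearMap.lsmul R X (x ^ n))

namespace Submodule

variable {x : R}

lemma mem_socleLayer {N : Submodule R X} {n : ℕ} {v : X} :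
    v ∈ N.socleLayer x n ↔ ∃ u ∈ N, x ^ (n + 1) • u = 0 ∧ x ^ n • u = v := by
  simp [socleLayer, and_assoc]

lemma socleLayer_mono {N N' : Submodule R X} (h : N ≤ N') {n n' : ℕ} (hn : n ≤ n') :
    N.socleLayer x n' ≤ N'.socleLayer x n := by
  intro v hv
  obtain ⟨u, hu, h0, rfl⟩ := mem_socleLayer.1 hv
  refine mem_socleLayer.2 ⟨x ^ (n' - n) • u, N'.smul_mem _ (h hu), ?_, ?_⟩
  · rw [smul_smul, ← pow_add, show n + 1 + (n' - n) = n' + 1 by lia, h0]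
  · rw [smul_smul, ← pow_add, show n + (n' - n) = n' by lia]

lemma socleLayer_le_ker (N : Submodule R X) (n : ℕ) :
    N.socleLayer x n ≤ LinearMap.ker (LinearMap.lsmul R X x) := by
  intro v hv
  obtain ⟨u, hu, h0, rfl⟩ := mem_socleLayer.1 hv
  simpa [smul_smul, ← pow_succ', pow_succ] using h0

/-- Induction on the exponent killing `u`: equality of layers gives `u'` in `N'` with the same image
under `x ^ n`, and `u - u'` is killed by the smaller power `x ^ n`. -/
lemma le_of_socleLayer_le (htors : ∀ z : X, ∃ n : ℕ, x ^ n • z = 0) {N N' : Submodule R X}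
    (hN : N' ≤ N) (h : ∀ n, N.socleLayer x n ≤ N'.socleLayer x n) : N ≤ N' := by
  have key (n : ℕ) : ∀ u ∈ N, x ^ n • u = 0 → u ∈ N' := by
    induction n with
    | zero =>
      intro u _ hu
      rw [pow_zero, one_smul] at hu
      exact hu ▸ N'.zero_mem
    | succ n ih =>
      intro u hu h0
      obtain ⟨u', hu', h0', h1⟩ := mem_socleLayer.1 (h n (mem_socleLayer.2 ⟨u, hu, h0, rfl⟩))
      have := ih (u - u') (N.sub_mem hu (hN hu')) (by rw [smul_sub, h1, sub_self])
      simpa using N'.add_mem this hu'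
  intro u hu
  obtain ⟨n, hn⟩ := htors u
  exact key n u hu hn

end Submodule

lemma Submodule.exists_stable_of_le (K : Submodule R X) [IsArtinian R K]
    (f : ℕ → Submodule R X) (hf : Antitone f) (hK : ∀ n, f n ≤ K) :
    ∃ n, ∀ m, n ≤ m → f n = f m := by
  obtain ⟨n, hn⟩ := IsArtinian.monotone_stabilizes (R := R) (M := K)
    ⟨fun n ↦ OrderDual.toDual ((f n).comap K.subtype), fun m n h ↦ Submodule.comap_mono (hf h)⟩
  refine ⟨n, fun m hm ↦ ?_⟩
  have h : (f n).comap K.subtype = (f m).comap K.subtype := hn m hm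
  simpa [Submodule.map_comap_subtype, inf_eq_right.2 (hK _)] using congr(($h).map K.subtype)

/-- If every element of `X` is killed by a power of `x` and the submodule of elements killed by
`x` is Artinian, then `X` is Artinian. -/
theorem isArtinian_of_isArtinian_ker_lsmul (x : R) (htors : ∀ z : X, ∃ n : ℕ, x ^ n • z = 0)
    [IsArtinian R (LinearMap.ker (LinearMap.lsmul R X x))] : IsArtinian R X := by
  rw [← monotone_stabilizes_iff_artinian]
  intro f
  have hf : Antitone (fun n ↦ (OrderDual.ofDual (f n) : Submodule R X)) := fun m n h ↦ f.monotone h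
  set g : ℕ → Submodule R X := fun n ↦ OrderDual.ofDual (f n)
  -- Layers decrease in both the submodule and the index, so stability of the diagonal chain
  -- controls all layers of index at least `n₀` at once. Only finitely many layers remain, each
  -- treated separately; `K` bounds all the stabilization points.
  obtain ⟨n₀, hn₀⟩ := Submodule.exists_stable_of_le (LinearMap.ker (LinearMap.lsmul R X x))
    (fun n ↦ (g n).socleLayer x n) (fun m n h ↦ Submodule.socleLayer_mono (hf h) h)
    (fun n ↦ Submodule.socleLayer_le_ker _ _)
  have (n : ℕ) := Submodule.exists_stable_of_le (LinearMap.ker (LinearMap.lsmul R X x))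
    (fun k ↦ (g k).socleLayer x n) (fun k l h ↦ Submodule.socleLayer_mono (hf h) le_rfl)
    (fun n ↦ Submodule.socleLayer_le_ker _ _)
  choose k hk using this
  let K := n₀ + ∑ n ∈ Finset.range n₀, k n
  refine ⟨K, fun m hm ↦ show g K = g m from
    le_antisymm (Submodule.le_of_socleLayer_le htors (hf hm) fun n ↦ ?_) (hf hm)⟩
  by_cases hn : n < n₀
  · have h1 : k n ≤ K := (Finset.single_le_sum (f := k) (fun _ _ ↦ Nat.zero_le _)
      (Finset.mem_range.2 hn)).trans (Nat.le_add_left _ _)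
    exact ((hk n K h1).symm.trans (hk n m (h1.trans hm))).le
  · calc (g K).socleLayer x n ≤ (g n₀).socleLayer x n₀ :=
          Submodule.socleLayer_mono (hf (Nat.le_add_right _ _)) (not_lt.1 hn)
      _ = (g (max m n)).socleLayer x (max m n) := hn₀ _ (by lia)
      _ ≤ (g m).socleLayer x n :=
          Submodule.socleLayer_mono (hf (le_max_left _ _)) (le_max_right _ _)

lemma isArtinian_of_exact {X Y Z : Type*} [AddCommGroup X] [Module R X] [AddCommGroup Y]
    [Module R Y] [AddCommGroup Z] [Module R Z] [IsArtinian R X] [IsArtinian R Z]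
    (f : X →ₗ[R] Y) (g : Y →ₗ[R] Z) (h : Function.Exact f g) : IsArtinian R Y :=
  have : IsArtinian R (LinearMap.range f) :=
    isArtinian_of_surjective X f.rangeRestrict f.surjective_rangeRestrict
  have : IsArtinian R (LinearMap.range g) := inferInstance
  isArtinian_of_range_eq_ker (LinearMap.range f).subtype g.rangeRestrict (by
    rw [Submodule.range_subtype, LinearMap.ker_rangeRestrict, h.linearMap_ker_eq])

end Artinian

/-! ### Exactness of sequential limits of Artinian modules. -/

section Limit

open Opposite

namespace ModuleCat

variable {R : Type u} [Ring R]

lemma exists_limit_π_eq {J : Type*} [Category* J] {F : J ⥤ ModuleCat.{u} R} [HasLimit F]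
    (s : ∀ j, F.obj j) (hs : ∀ ⦃i j⦄ (f : i ⟶ j), F.map f (s i) = s j) :
    ∃ z : (limit F : ModuleCat.{u} R), ∀ j, limit.π F j z = s j := by
  let c : Cone F :=
    { pt := ModuleCat.of R R
      π :=
        { app j := ModuleCat.ofHom (LinearMap.toSpanSingleton R (F.obj j) (s j))
          naturality i j f := by
            ext
            simp [hs f] } }
  refine ⟨limit.lift F c (1 : R), fun j ↦ ?_⟩
  exact (congr($(limit.lift_π c j) (1 : R))).trans (one_smul R _)

lemma limit_hom_ext {F : ℕᵒᵖ ⥤ ModuleCat.{u} R} {z w : (limit F : ModuleCat.{u} R)}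
    (h : ∀ j, limit.π F j z = limit.π F j w) : z = w :=
  Concrete.limit_ext _ _ _ h

variable {F G H : ℕᵒᵖ ⥤ ModuleCat.{u} R} (α : F ⟶ G) (β : G ⟶ H)

/-- The inverse system of preimages of a compatible family under a morphism of inverse systems. -/
def preimageTower (y : ∀ n, G.obj n) (hy : ∀ ⦃m n⦄ (f : m ⟶ n), G.map f (y m) = y n) :
    ℕᵒᵖ ⥤ Type u where
  obj n := {x : F.obj n // α.app n x = y n}
  map f := ↾fun x ↦ ⟨F.map f x.1,
    congr($(α.naturality f) x.1).trans ((congrArg (G.map f) x.2).trans (hy f))⟩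
  map_id n := by
    ext x
    exact congr($(F.map_id n) x.1)
  map_comp f g := by
    ext x
    exact congr($(F.map_comp f g) x.1)

/-- The fibres are cosets of the kernels of `α`, so their images at level `n` are cosets of the
decreasing submodules `I m`, which stabilize in the Artinian module `F.obj n`. -/
lemma isMittagLeffler_preimageTower [∀ n, IsArtinian R (F.obj n)] (y : ∀ n, G.obj n)
    (hy : ∀ ⦃m n⦄ (f : m ⟶ n), G.map f (y m) = y n) (hne : ∀ n, ∃ x, α.app n x = y n) :
    (preimageTower α y hy).IsMittagLeffler := by
  intro n
  let I (m : ℕ) : Submodule R (F.obj n) :=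
    (LinearMap.ker (α.app (op (n.unop + m))).hom).map
      (F.map (homOfLE (Nat.le_add_right n.unop m)).op).hom
  have hI : Antitone I := by
    intro m m' h
    rintro _ ⟨x, hx, rfl⟩
    let f : op (n.unop + m') ⟶ op (n.unop + m) := (homOfLE (by lia)).op
    refine ⟨F.map f x, ?_, congr($(F.map_comp f (homOfLE (Nat.le_add_right n.unop m)).op) x).symm⟩
    have := congr($(α.naturality f) x)
    exact this.trans ((congrArg (G.map f) hx).trans (map_zero _))
  obtain ⟨N, hN⟩ := IsArtinian.monotone_stabilizes (R := R) (M := F.obj n)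
    ⟨fun n ↦ OrderDual.toDual (I n), hI⟩
  refine ⟨op (n.unop + N), (homOfLE (Nat.le_add_right n.unop N)).op, fun k g ↦ ?_⟩
  rintro _ ⟨⟨x, hx⟩, rfl⟩
  -- Take any point `x'` of the fibre at a level beyond both `n + N` and `k`. At level `n + N` it
  -- differs from `x` by a kernel element, whose image lies in `I N = I (max N k)`; correcting `x'`
  -- by the resulting `w` gives a point with the same image as `x`.
  obtain ⟨x', hx'⟩ := hne (op (n.unop + max N k.unop))
  let f₁ : op (n.unop + max N k.unop) ⟶ op (n.unop + N) := (homOfLE (by lia)).op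
  let f₂ : op (n.unop + max N k.unop) ⟶ k := (homOfLE (by lia)).op
  let f₃ : op (n.unop + N) ⟶ n := (homOfLE (Nat.le_add_right n.unop N)).op
  let f₄ : op (n.unop + max N k.unop) ⟶ n := (homOfLE (by lia)).op
  have hx₁ : α.app _ (F.map f₁ x') = y _ := by
    rw [← hy f₁, ← hx']; exact congr($(α.naturality f₁) x')
  have hmem : F.map f₃ (x - F.map f₁ x') ∈ I N :=
    ⟨_, (map_sub (α.app _).hom _ _).trans (sub_eq_zero.2 (hx.trans hx₁.symm)), rfl⟩
  rw [show I N = I (max N k.unop) from hN _ (le_max_left _ _)] at hmem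
  obtain ⟨w, hw, hw'⟩ := hmem
  have hw' : F.map f₄ w = F.map f₃ x - F.map f₄ x' := by
    refine hw'.trans ((map_sub _ _ _).trans ?_)
    exact congr(F.map f₃ x - $(F.map_comp f₁ f₃) x').symm
  have hw0 : α.app _ w = 0 := hw
  refine ⟨⟨F.map f₂ (w + x'), ?_⟩, Subtype.ext ?_⟩
  · refine (congr($(α.naturality f₂) (w + x'))).trans ?_
    refine Eq.trans ?_ (hy f₂)
    exact congrArg (G.map f₂) ((map_add (α.app _).hom w x').trans
      (by rw [← hx']; exact (congrArg (· + _) hw0).trans (zero_add _)))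
  · refine (congr($(F.map_comp f₂ g) (w + x'))).symm.trans ?_
    refine (map_add (F.map f₄).hom w x').trans ?_
    refine (congrArg (· + _) hw').trans (sub_add_cancel _ _)

/-- The eventual ranges form a tower of nonempty sets with surjective transition maps, so a section
can be lifted step by step. -/
lemma nonempty_sections_of_isMittagLeffler (T : ℕᵒᵖ ⥤ Type u) (hT : T.IsMittagLeffler)
    [∀ n, Nonempty (T.obj n)] : T.sections.Nonempty := by
  have := T.toEventualRanges_nonempty hT
  obtain ⟨z, -⟩ := Types.surjective_π_app_zero_of_surjective_map
    (limit.isLimit T.toEventualRanges)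
    (fun n ↦ T.surjective_toEventualRanges hT (homOfLE n.le_succ).op)
    (this (op 0)).some
  exact ⟨_, (T.toEventualRangesSectionsEquiv (Types.limitEquivSections _ z)).2⟩

/-- Sequential limits are exact on inverse systems of Artinian modules. -/
theorem exact_limMap [∀ n, IsArtinian R (F.obj n)]
    (h : ∀ n, Function.Exact (α.app n) (β.app n)) :
    Function.Exact (limMap α) (limMap β) := by
  intro z
  constructor
  · intro hz
    have hy : ∀ ⦃m n⦄ (f : m ⟶ n), G.map f (limit.π G m z) = limit.π G n z :=
      fun m n f ↦ congr($(limit.w G f) z)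
    have hne (n) : ∃ x, α.app n x = limit.π G n z := by
      refine (h n _).1 ?_
      refine (congr($(limMap_π β n) z)).symm.trans ?_
      exact (congrArg (limit.π H n) hz).trans (map_zero _)
    have (n : ℕᵒᵖ) : Nonempty ((preimageTower α _ hy).obj n) :=
      ⟨⟨_, (hne n).choose_spec⟩⟩
    obtain ⟨s, hs⟩ := nonempty_sections_of_isMittagLeffler _
      (isMittagLeffler_preimageTower α _ hy hne)
    obtain ⟨x, hx⟩ := exists_limit_π_eq (F := F) (fun n ↦ (s n).1)
      (fun m n f ↦ congrArg Subtype.val (hs f))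
    refine ⟨x, limit_hom_ext fun n ↦ ?_⟩
    refine (congr($(limMap_π α n) x)).trans ?_
    exact (congrArg (α.app n) (hx n)).trans (s n).2
  · rintro ⟨x, rfl⟩
    refine limit_hom_ext fun n ↦ ?_
    rw [map_zero]
    refine (congr($(limMap_π β n) _)).trans ?_
    refine (congrArg (β.app n) congr($(limMap_π α n) x)).trans ?_
    exact (h n).apply_apply_eq_zero _

end ModuleCat

end Limit

/-! ### Power torsion in injective modules. -/

section PowTorsion

variable {R : Type*} [CommRing R] (J : Ideal R) (E : Type*) [AddCommGroup E] [Module R E]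

/-- A module is `J`-power torsion if each of its elements is killed by a power of `J`. -/
def Ideal.IsPowTorsion : Prop :=
  ∀ x : E, ∃ k : ℕ, ∀ r ∈ J ^ k, r • x = 0

/-- The submodule of elements killed by a power of `J`. -/
def Ideal.powTorsion : Submodule R E where
  carrier := {x | ∃ k : ℕ, ∀ r ∈ J ^ k, r • x = 0}
  add_mem' := by
    rintro x y ⟨k, hk⟩ ⟨l, hl⟩
    refine ⟨max k l, fun r hr ↦ ?_⟩
    rw [smul_add, hk r (Ideal.pow_le_pow_right (le_max_left k l) hr),
      hl r (Ideal.pow_le_pow_right (le_max_right k l) hr), add_zero]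
  zero_mem' := ⟨0, fun r _ ↦ smul_zero r⟩
  smul_mem' := by
    rintro s x ⟨k, hk⟩
    exact ⟨k, fun r hr ↦ by rw [smul_comm, hk r hr, smul_zero]⟩

variable {J E}

lemma Ideal.isPowTorsion_powTorsion : J.IsPowTorsion (J.powTorsion E) := by
  rintro ⟨x, k, hk⟩
  exact ⟨k, fun r hr ↦ Subtype.ext (hk r hr)⟩

lemma Ideal.IsPowTorsion.of_surjective {E' : Type*} [AddCommGroup E'] [Module R E']
    (h : J.IsPowTorsion E) (f : E →ₗ[R] E') (hf : Function.Surjective f) : J.IsPowTorsion E' := by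
  intro x
  obtain ⟨x, rfl⟩ := hf x
  obtain ⟨k, hk⟩ := h x
  exact ⟨k, fun r hr ↦ by rw [← map_smul, hk r hr, map_zero]⟩

lemma Ideal.IsPowTorsion.of_injective {E' : Type*} [AddCommGroup E'] [Module R E']
    (h : J.IsPowTorsion E') (f : E →ₗ[R] E') (hf : Function.Injective f) : J.IsPowTorsion E := by
  intro x
  obtain ⟨k, hk⟩ := h (f x)
  exact ⟨k, fun r hr ↦ hf (by rw [map_smul, hk r hr, map_zero])⟩

lemma Ideal.IsPowTorsion.exists_pow [Module.Finite R E] (h : J.IsPowTorsion E) :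
    ∃ n : ℕ, ∀ r ∈ J ^ n, ∀ x : E, r • x = 0 := by
  obtain ⟨S, hS⟩ := Module.Finite.fg_top (R := R) (M := E)
  choose k hk using h
  refine ⟨S.sup k, fun r hr x ↦ ?_⟩
  have : Submodule.span R (S : Set E) ≤ LinearMap.ker (LinearMap.lsmul R E r) :=
    Submodule.span_le.2 fun s hs ↦ hk s r (Ideal.pow_le_pow_right (Finset.le_sup hs) hr)
  exact this (hS ▸ Submodule.mem_top)

/-- Over a Noetherian ring the `J`-power torsion submodule of an injective module is injective. -/
theorem Module.Baer.powTorsion {R E : Type u} [CommRing R] [IsNoetherianRing R] [AddCommGroup E]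
    [Module R E] [Module.Injective R E] (J : Ideal R) : Module.Baer R (J.powTorsion E) := by
  intro I g
  -- The range of `g` is finitely generated, so one power `J ^ n` kills it. Artin-Rees gives `J ^ (n
  -- + k) ∩ I = J ^ n (J ^ k ∩ I)`, which `g` therefore kills.
  obtain ⟨n, hn⟩ := (Ideal.isPowTorsion_powTorsion.of_injective
    (LinearMap.range g).subtype Subtype.val_injective).exists_pow (J := J)
  obtain ⟨k, hk⟩ := J.exists_pow_inf_eq_pow_smul (M := R) I
  have hker : Submodule.comap I.subtype (J ^ (n + k)) ≤ LinearMap.ker g := by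
    have key : J ^ n • (J ^ k • (⊤ : Submodule R R) ⊓ I) ≤
        (LinearMap.ker g).map I.subtype := by
      refine Submodule.smul_le.2 fun r hr b hb ↦ ⟨r • ⟨b, hb.2⟩, ?_, rfl⟩
      rw [SetLike.mem_coe, LinearMap.mem_ker, map_smul]
      exact congrArg Subtype.val (hn r hr ⟨g ⟨b, hb.2⟩, LinearMap.mem_range_self g _⟩)
    intro a ha
    have h := hk (n + k) (by lia)
    rw [Nat.add_sub_cancel] at h
    obtain ⟨b, hb, hab⟩ := key (h ▸ ⟨by simpa using ha, a.2⟩ : (a : R) ∈ _)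
    exact Subtype.val_injective hab ▸ hb
  -- Extending along this injection, rather than along `I → R`, makes the extension vanish on `J ^
  -- (n + k)` and hence land in the torsion submodule.
  let φ : I ⧸ Submodule.comap I.subtype (J ^ (n + k)) →ₗ[R] R ⧸ J ^ (n + k) :=
    Submodule.mapQ _ _ I.subtype le_rfl
  have hφ : Function.Injective φ := by
    rw [← LinearMap.ker_eq_bot, Submodule.ker_mapQ]
    simp
  obtain ⟨h, hh⟩ := Module.Injective.out φ hφ
    ((J.powTorsion E).subtype ∘ₗ Submodule.liftQ _ g hker)
  refine ⟨LinearMap.codRestrict _ (h ∘ₗ Submodule.mkQ (J ^ (n + k)))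
    fun r ↦ ⟨n + k, fun s hs ↦ ?_⟩, fun x hx ↦ Subtype.ext ?_⟩
  · rw [LinearMap.comp_apply, ← map_smul, ← map_smul, Submodule.mkQ_apply,
      (Submodule.Quotient.mk_eq_zero (J ^ (n + k)) (x := s • r)).2 (Ideal.mul_mem_right _ _ hs),
      map_zero]
  · exact hh (Submodule.Quotient.mk ⟨x, hx⟩)

end PowTorsion

/-! ### Local cohomology of power torsion modules. -/

namespace localCohomology

open Abelian

variable {R : Type u} [CommRing R] {J : Ideal R}

lemma isPowTorsion (i : ℕ) (M : ModuleCat.{u} R) :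
    J.IsPowTorsion ((localCohomology J i).obj M) :=
  exists_pow_smul_eq_zero J i

lemma subsingleton_of_injective (M : ModuleCat.{u} R) [Injective M] (i : ℕ) :
    Subsingleton ((localCohomology J (i + 1)).obj M) := by
  refine subsingleton_of_forall_eq 0 fun z ↦ ?_
  obtain ⟨k, e, rfl⟩ := exists_fromExt_eq J _ M z
  rw [Ext.eq_zero_of_injective e, map_zero]

/-- A map from `R / J ^ k` to `M` is determined by the image of `1`; a lift of that image to `E` is
killed by some `J ^ l`, so it defines a map from `R / J ^ (max k l)`. -/
lemma map_zero_surjective {E M : ModuleCat.{u} R} (hE : J.IsPowTorsion E) (g : E ⟶ M)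
    (hg : Function.Surjective g) : Function.Surjective ((localCohomology J 0).map g) := by
  intro w
  obtain ⟨k, e, rfl⟩ := exists_fromExt_eq J _ _ w
  obtain ⟨φ, rfl⟩ := (Ext.mk₀_bijective _ _).2 e
  obtain ⟨x, hx⟩ := hg (φ (Submodule.Quotient.mk 1))
  obtain ⟨l, hl⟩ := hE x
  let ψ : quotientPow J (max k l) ⟶ E := ModuleCat.ofHom
    (Submodule.liftQ _ (LinearMap.toSpanSingleton R E x)
      fun r hr ↦ hl r (Ideal.pow_le_pow_right (le_max_right k l) hr))
  have hψ : ψ ≫ g = quotientPowMap J (le_max_left k l) ≫ φ := by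
    ext
    refine Eq.trans ?_ hx
    exact congrArg g (one_smul R x)
  refine ⟨fromExt J 0 _ E (Ext.mk₀ ψ), ?_⟩
  rw [map_fromExt, Ext.mk₀_comp_mk₀, hψ, ← Ext.mk₀_comp_mk₀, fromExt_precomp]

/-- Replacing an injective module containing `T` by its torsion submodule keeps it injective and
still containing `T`. The cokernel is then torsion too, which permits dimension shifting. -/
lemma exists_shortExact_injective [IsNoetherianRing R] (T : ModuleCat.{u} R)
    (hT : J.IsPowTorsion T) :
    ∃ S : ShortComplex (ModuleCat.{u} R), S.ShortExact ∧ S.X₁ = T ∧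
      J.IsPowTorsion S.X₂ ∧ Injective S.X₂ := by
  let I : ModuleCat.{u} R := Injective.under T
  let E := J.powTorsion I
  have : Injective (ModuleCat.of R I) := inferInstanceAs (Injective (Injective.under T))
  have : Module.Injective R I :=
    Module.injective_module_of_injective_object R _
  have : Module.Injective R E := (Module.Baer.powTorsion J).injective
  let f : T →ₗ[R] E := LinearMap.codRestrict _ (Injective.ι T).hom fun x ↦ by
    obtain ⟨k, hk⟩ := hT x
    exact ⟨k, fun r hr ↦ by rw [← map_smul, hk r hr, map_zero]⟩
  have hf : Function.Injective f := fun x y h ↦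
    (ModuleCat.mono_iff_injective (Injective.ι T)).1 inferInstance congr(($h).1)
  refine ⟨ShortComplex.mk (ModuleCat.ofHom f) (ModuleCat.ofHom (LinearMap.range f).mkQ) ?_,
    ModuleCat.shortComplex_shortExact _ ?_ hf (Submodule.mkQ_surjective _), rfl,
    Ideal.isPowTorsion_powTorsion, Module.injective_object_of_injective_module R E⟩
  · ext x
    simp
  · exact LinearMap.exact_map_mkQ_range f

/-- The higher local cohomology of a `J`-power torsion module vanishes. -/
theorem subsingleton_of_isPowTorsion [IsNoetherianRing R] (i : ℕ) (T : ModuleCat.{u} R)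
    (hT : J.IsPowTorsion T) : Subsingleton ((localCohomology J (i + 1)).obj T) := by
  induction i generalizing T with
  | zero =>
    obtain ⟨S, hS, rfl, hE, hI⟩ := exists_shortExact_injective T hT
    have := subsingleton_of_injective (J := J) S.X₂ 0
    refine subsingleton_of_forall_eq 0 fun z ↦ ?_
    obtain ⟨w, rfl⟩ := (exact_δ_map J 0 hS z).1 (Subsingleton.elim _ _)
    exact (exact_map_δ J 0 hS w).2 (map_zero_surjective hE S.g hS.moduleCat_surjective_g w)
  | succ i ih =>
    obtain ⟨S, hS, rfl, hE, hI⟩ := exists_shortExact_injective T hT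
    have := subsingleton_of_injective (J := J) S.X₂ (i + 1)
    have := ih S.X₃ (hE.of_surjective S.g.hom hS.moduleCat_surjective_g)
    refine subsingleton_of_forall_eq 0 fun z ↦ ?_
    obtain ⟨w, rfl⟩ := (exact_δ_map J (i + 1) hS z).1 (Subsingleton.elim _ _)
    rw [Subsingleton.elim w 0, map_zero]

/-- As `J` kills `M`, every map from `R / J ^ k` comes from one on `R / J`. So degree 0 is a
quotient of `Hom(R / J, M)`, which embeds in `M` by evaluation at `1`. -/
lemma isArtinian_zero (M : ModuleCat.{u} R) [IsArtinian R M] (hM : ∀ r ∈ J, ∀ x : M, r • x = 0) :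
    IsArtinian R ((localCohomology J 0).obj M) := by
  let ev : Ext.{u} (quotientPow J 1) M 0 →ₗ[R] M :=
    LinearMap.applyₗ (Submodule.Quotient.mk 1) ∘ₗ
      (Ext.linearEquiv₀.trans ModuleCat.homLinearEquiv).toLinearMap
  have hev (φ : quotientPow J 1 ⟶ M) : ev (Ext.mk₀ φ) = φ (Submodule.Quotient.mk 1) :=
    congr($(Ext.linearEquiv₀.apply_symm_apply (R := R) φ) (Submodule.Quotient.mk 1))
  have : IsArtinian R (Ext.{u} (quotientPow J 1) M 0) := by
    refine isArtinian_of_injective ev ((injective_iff_map_eq_zero ev).2 fun e he ↦ ?_)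
    obtain ⟨φ, rfl⟩ := (Ext.mk₀_bijective _ _).2 e
    rw [hev] at he
    have : φ = 0 := by
      ext
      exact he
    rw [this, Ext.mk₀_zero]
  refine isArtinian_of_surjective _ (fromExt J 0 1 M) fun z ↦ ?_
  obtain ⟨k, e, rfl⟩ := exists_fromExt_eq J _ _ z
  obtain ⟨φ, rfl⟩ := (Ext.mk₀_bijective _ _).2 e
  let ψ : quotientPow J 1 ⟶ M := ModuleCat.ofHom
    (Submodule.liftQ _ (LinearMap.toSpanSingleton R M (φ (Submodule.Quotient.mk 1)))
      fun r hr ↦ hM r (by simpa using hr) _)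
  have hψ : quotientPowMap J (le_max_left k 1) ≫ φ =
      quotientPowMap J (le_max_right k 1) ≫ ψ := by
    ext
    exact (one_smul R _).symm
  refine ⟨Ext.mk₀ ψ, ?_⟩
  rw [← fromExt_precomp J 0 (le_max_left k 1), ← fromExt_precomp J 0 (le_max_right k 1),
    Ext.mk₀_comp_mk₀, Ext.mk₀_comp_mk₀, hψ]

end localCohomology

/-! ### Artinianness of local cohomology of finite modules. -/

namespace localCohomology

variable {R : Type u} [CommRing R]

/-- The property that all local cohomology modules of `M` with support in `J` are Artinian. -/
def HasArtinianLocalCohomology (J : Ideal R) (M : ModuleCat.{u} R) : Prop :=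
  ∀ i, IsArtinian R ((localCohomology J i).obj M)

variable {J : Ideal R}

lemma HasArtinianLocalCohomology.of_iso {M N : ModuleCat.{u} R}
    (h : HasArtinianLocalCohomology J M) (e : M ≅ N) : HasArtinianLocalCohomology J N := fun i ↦
  have := h i
  (((localCohomology J i).mapIso e).toLinearEquiv.isArtinian_iff).1 inferInstance

lemma HasArtinianLocalCohomology.of_shortExact {S : ShortComplex (ModuleCat.{u} R)}
    (hS : S.ShortExact) (h₁ : HasArtinianLocalCohomology J S.X₁)
    (h₃ : HasArtinianLocalCohomology J S.X₃) : HasArtinianLocalCohomology J S.X₂ := fun i ↦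
  have := h₁ i
  have := h₃ i
  isArtinian_of_exact ((localCohomology J i).map S.f).hom ((localCohomology J i).map S.g).hom
    (exact_map_map J i hS)

lemma hasArtinianLocalCohomology_of_smul_eq_zero [IsNoetherianRing R] (M : ModuleCat.{u} R)
    [IsArtinian R M] (hM : ∀ r ∈ J, ∀ x : M, r • x = 0) : HasArtinianLocalCohomology J M
  | 0 => isArtinian_zero M hM
  | i + 1 =>
    have := subsingleton_of_isPowTorsion (J := J) i M
      fun x ↦ ⟨1, fun r hr ↦ hM r (by simpa using hr) x⟩
    inferInstance

/-- If multiplication by `y ∈ J` is injective on `M` and the local cohomology of `M / y M` is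
Artinian, then so is the local cohomology of `M`. -/
lemma hasArtinianLocalCohomology_of_smul {X Z : ModuleCat.{u} R} {f : X ⟶ X} {g : X ⟶ Z}
    {w : f ≫ g = 0} (hS : (ShortComplex.mk f g w).ShortExact) {y : R} (hy : y ∈ J)
    (hf : f = y • 𝟙 X) (h₃ : HasArtinianLocalCohomology J Z) :
    HasArtinianLocalCohomology J X := by
  subst hf
  have hmap (i : ℕ) (z : (localCohomology J i).obj X) :
      (localCohomology J i).map (y • 𝟙 X) z = y • z := by
    rw [map_smul_apply, CategoryTheory.Functor.map_id]
    rfl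
  intro i
  -- The long exact sequence makes this kernel zero in degree 0 and the image of the preceding
  -- cohomology of `Z` in higher degrees.
  have : IsArtinian R (LinearMap.ker (LinearMap.lsmul R ((localCohomology J i).obj X) y)) := by
    cases i with
    | zero =>
      have : LinearMap.ker (LinearMap.lsmul R ((localCohomology J 0).obj X) y) = ⊥ := by
        rw [LinearMap.ker_eq_bot]
        intro z w h
        exact map_injective_zero J hS (((hmap 0 z).trans h).trans (hmap 0 w).symm)
      rw [this]
      infer_instance
    | succ i =>
      have := h₃ i
      have : LinearMap.ker (LinearMap.lsmul R ((localCohomology J (i + 1)).obj X) y) =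
          LinearMap.range (δ J i hS) := by
        ext z
        exact (hmap (i + 1) z).congr_left.symm.trans (exact_δ_map J i hS z)
      rw [this]
      exact isArtinian_of_surjective _ (δ J i hS).rangeRestrict
        (δ J i hS).surjective_rangeRestrict
  refine isArtinian_of_isArtinian_ker_lsmul y fun z ↦ ?_
  obtain ⟨k, hk⟩ := isPowTorsion (J := J) i X z
  exact ⟨k, hk _ (Ideal.pow_mem_pow hy k)⟩

/-- The short exact sequence `0 ⟶ R / (I : y) ⟶ R / I ⟶ R / (I + (y)) ⟶ 0`. -/
def colonShortComplex (I K : Ideal R) (y : R) (hK : ∀ r, r ∈ K ↔ y * r ∈ I) :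
    ShortComplex (ModuleCat.{u} R) where
  X₁ := ModuleCat.of R (R ⧸ K)
  X₂ := ModuleCat.of R (R ⧸ I)
  X₃ := ModuleCat.of R (R ⧸ (I ⊔ Ideal.span {y}))
  f := ModuleCat.ofHom (Submodule.mapQ K I (LinearMap.lsmul R R y) fun r hr ↦ (hK r).1 hr)
  g := ModuleCat.ofHom (Submodule.factor le_sup_left)
  zero := by
    ext
    exact (Submodule.Quotient.mk_eq_zero _).2
      (Ideal.mul_mem_right _ _ (Ideal.mem_sup_right (Ideal.mem_span_singleton_self y)))

lemma colonShortComplex_shortExact (I K : Ideal R) (y : R) (hK : ∀ r, r ∈ K ↔ y * r ∈ I) :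
    (colonShortComplex I K y hK).ShortExact := by
  refine ModuleCat.shortComplex_shortExact _ ?_ ?_ 
    (Submodule.factor_surjective (le_sup_left : I ≤ I ⊔ Ideal.span {y}))
  · intro z
    obtain ⟨r, rfl⟩ := Submodule.Quotient.mk_surjective _ z
    constructor
    · intro h
      obtain ⟨a, ha, b, hb, rfl⟩ := Submodule.mem_sup.1 ((Submodule.Quotient.mk_eq_zero _).1 h)
      obtain ⟨c, rfl⟩ := Ideal.mem_span_singleton'.1 hb
      refine ⟨Submodule.Quotient.mk c, (Submodule.Quotient.eq _).2 ?_⟩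
      have : y * c - (a + c * y) = -a := by ring
      exact this ▸ I.neg_mem ha
    · rintro ⟨c, hc⟩
      rw [← hc]
      exact congr($((colonShortComplex I K y hK).zero) c)
  · refine (injective_iff_map_eq_zero (colonShortComplex I K y hK).f.hom).2 fun z hz ↦ ?_
    obtain ⟨r, rfl⟩ := Submodule.Quotient.mk_surjective _ z
    exact (Submodule.Quotient.mk_eq_zero _).2 ((hK r).2 ((Submodule.Quotient.mk_eq_zero _).1 hz))

/-- Noetherian induction on `I`. If `J ≤ I`, the quotient is zero or simple. Otherwise take `y` in
`J` outside `I`: either `(I : y)` is strictly larger and `R / I` is an extension of smaller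
quotients, or `y` is regular on `R / I`. -/
lemma hasArtinianLocalCohomology_quotient [IsNoetherianRing R] [hJ : J.IsMaximal] (I : Ideal R) :
    HasArtinianLocalCohomology J (ModuleCat.of R (R ⧸ I)) := by
  induction I using IsNoetherian.induction with
  | hgt I ih =>
  by_cases hI : J ≤ I
  · have : IsArtinian R (R ⧸ I) := by
      rcases hJ.out.le_iff.1 hI with rfl | rfl
      · infer_instance
      · have := isSimpleModule_iff_isCoatom.2 hJ.out
        infer_instance
    refine hasArtinianLocalCohomology_of_smul_eq_zero _ fun r hr x ↦ ?_
    obtain ⟨s, rfl⟩ := Submodule.Quotient.mk_surjective _ x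
    exact (Submodule.Quotient.mk_eq_zero _).2 (Ideal.mul_mem_right _ I (hI hr))
  · obtain ⟨y, hyJ, hyI⟩ := SetLike.not_le_iff_exists.1 hI
    let K : Ideal R := Submodule.comap (LinearMap.lsmul R R y) I
    have hK (r) : r ∈ K ↔ y * r ∈ I := Iff.rfl
    have hIK : I ≤ K := fun r hr ↦ Ideal.mul_mem_left I y hr
    have h₃ := ih (I ⊔ Ideal.span {y}) (lt_of_le_of_ne le_sup_left
      fun h ↦ hyI (h ▸ Ideal.mem_sup_right (Ideal.mem_span_singleton_self y)))
    rcases hIK.lt_or_eq with h | h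
    · exact .of_shortExact (colonShortComplex_shortExact I K y hK) (ih K h) h₃
    · rw [← h] at hK
      refine hasArtinianLocalCohomology_of_smul (f := (colonShortComplex I I y hK).f)
        (colonShortComplex_shortExact I I y hK) hyJ ?_ h₃
      ext
      rfl

/-- The local cohomology of a finitely generated module over a Noetherian ring, with support in a
maximal ideal, is Artinian. -/
theorem hasArtinianLocalCohomology [IsNoetherianRing R] [hJ : J.IsMaximal] (M : Type u)
    [AddCommGroup M] [Module R M] [hM : Module.Finite R M] :
    HasArtinianLocalCohomology J (ModuleCat.of R M) := by
  -- A finite module is built by extensions from quotients by prime ideals.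
  induction hM using IsNoetherianRing.induction_on_isQuotientEquivQuotientPrime R with
  | subsingleton N =>
    exact hasArtinianLocalCohomology_of_smul_eq_zero _ fun r _ x ↦ Subsingleton.elim (α := N) _ _
  | quotient N p e =>
    exact (hasArtinianLocalCohomology_quotient p.asIdeal).of_iso e.symm.toModuleIso
  | exact N₁ N₂ N₃ f g hf hg h h₁ h₃ =>
    exact .of_shortExact (ModuleCat.shortComplex_shortExact
      (ShortComplex.mk (ModuleCat.ofHom f) (ModuleCat.ofHom g)
        (by ext x; exact h.apply_apply_eq_zero x)) h hf hg) h₁ h₃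

end localCohomology

/-! ### Projective resolutions with finitely generated terms. -/

namespace FGModuleCat

variable {R : Type u} [CommRing R] [IsNoetherianRing R]

lemma surjective_of_epi {M N : FGModuleCat.{u} R} (f : M ⟶ N) [Epi f] :
    Function.Surjective f.hom := by
  have : Epi ((forget₂ (FGModuleCat.{u} R) (ModuleCat.{u} R)).map f) := inferInstance
  exact (ModuleCat.epi_iff_surjective _).1 this

lemma epi_of_surjective {M N : FGModuleCat.{u} R} (f : M ⟶ N) (hf : Function.Surjective f.hom) :
    Epi f :=
  (forget₂ (FGModuleCat.{u} R) (ModuleCat.{u} R)).epi_of_epi_map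
    ((ModuleCat.epi_iff_surjective f.hom).2 hf)

lemma projective_of_moduleProjective (P : Type u) [AddCommGroup P] [Module R P] [Module.Finite R P]
    [Module.Projective R P] : Projective (FGModuleCat.of R P) where
  factors {E X} f e _ := by
    obtain ⟨g, hg⟩ := Module.projective_lifting_property e.hom.hom f.hom.hom (surjective_of_epi e)
    exact ⟨InducedCategory.homMk (ModuleCat.ofHom g), by ext x; exact congr($hg x)⟩

lemma exists_epi_of_projective (M : FGModuleCat.{u} R) :
    ∃ (n : ℕ) (f : FGModuleCat.of R (Fin n → R) ⟶ M), Epi f := by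
  obtain ⟨n, f, hf⟩ := Module.Finite.exists_fin' R M
  exact ⟨n, InducedCategory.homMk (ModuleCat.ofHom f), epi_of_surjective _ hf⟩

instance : EnoughProjectives (FGModuleCat.{u} R) where
  presentation M := by
    obtain ⟨n, f, hf⟩ := exists_epi_of_projective M
    exact ⟨{ p := _, projective := projective_of_moduleProjective (Fin n → R), f := f, epi := hf }⟩

instance : (forget₂ (FGModuleCat.{u} R) (ModuleCat.{u} R)).PreservesProjectiveObjects where
  projective_obj {P} hP := by
    obtain ⟨n, f, hf⟩ := exists_epi_of_projective P
    have hs := Projective.factorThru_comp (𝟙 P) f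
    have : Module.Projective R P := Module.Projective.of_split
      (Projective.factorThru (𝟙 P) f).hom.hom f.hom.hom (congr(($hs).hom.hom))
    exact (IsProjective.iff_projective P).1 this

/-- A finitely generated module over a Noetherian ring has a resolution by finitely generated
projective modules. -/
lemma exists_finite_projectiveResolution (N : Type u) [AddCommGroup N] [Module R N]
    [Module.Finite R N] :
    ∃ P : ProjectiveResolution (ModuleCat.of R N), ∀ j, Module.Finite R (P.complex.X j) :=
  ⟨(forget₂ (FGModuleCat.{u} R) (ModuleCat.{u} R)).mapProjectiveResolution
    (projectiveResolution (FGModuleCat.of R N)),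
    fun j ↦ inferInstanceAs
      (Module.Finite R ((projectiveResolution (FGModuleCat.of R N)).complex.X j))⟩

end FGModuleCat

/-! ### Tor by a fixed resolution, and its Artinianness. -/

namespace ModuleCat

open MonoidalCategory

variable {R : Type u} [CommRing R] {N : ModuleCat.{u} R} (P : ProjectiveResolution N)

/-- The functor `X ↦ P ⊗ X` from modules to complexes, for a projective resolution `P`. -/
def tensorResolution : ModuleCat.{u} R ⥤ ChainComplex (ModuleCat.{u} R) ℕ where
  obj X := (((tensoringRight _).obj X).mapHomologicalComplex _).obj P.complex
  map f := (NatTrans.mapHomologicalComplex ((tensoringRight _).map f) _).app P.complex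
  map_id X := by
    ext1 i
    exact MonoidalCategory.whiskerLeft_id _ _
  map_comp f g := by
    ext1 i
    exact MonoidalCategory.whiskerLeft_comp _ _ _

instance : (tensorResolution P).PreservesZeroMorphisms where
  map_zero X Y := by
    ext1 i
    exact MonoidalPreadditive.whiskerLeft_zero

lemma shortExact_map_tensorResolution {S : ShortComplex (ModuleCat.{u} R)} (hS : S.ShortExact) :
    (S.map (tensorResolution P)).ShortExact := by
  refine HomologicalComplex.shortExact_of_degreewise_shortExact _ fun i ↦ ?_
  have : Module.Projective R (P.complex.X i) :=
    (IsProjective.iff_projective _).2 (P.projective i)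
  refine ModuleCat.shortComplex_shortExact _ ?_ ?_ ?_
  · exact Module.Flat.lTensor_exact (P.complex.X i)
      ((ShortComplex.ShortExact.moduleCat_exact_iff_function_exact _).1 hS.exact)
  · exact Module.Flat.lTensor_preserves_injective_linearMap _ hS.moduleCat_injective_f
  · exact LinearMap.lTensor_surjective _ hS.moduleCat_surjective_g

/-- `Tor_j(N, X)` computed by a chosen projective resolution of `N`. -/
def resTor (j : ℕ) : ModuleCat.{u} R ⥤ ModuleCat.{u} R :=
  tensorResolution P ⋙ HomologicalComplex.homologyFunctor _ _ j

/-- `Tor_j(N, X)` is computed by any projective resolution of `N`. -/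
def torModuleIso (j : ℕ) (X : ModuleCat.{u} R) : torModule j N X ≅ (resTor P j).obj X :=
  P.isoLeftDerivedObj ((tensoringRight _).obj X) j

/-- Tor is a subquotient of `P_j ⊗ X`, itself a quotient of a finite power of `X`. -/
lemma isArtinian_resTor_of_isArtinian (hP : ∀ j, Module.Finite R (P.complex.X j)) (j : ℕ)
    (X : ModuleCat.{u} R) [IsArtinian R X] : IsArtinian R ((resTor P j).obj X) := by
  have := hP j
  have hX : IsArtinian R (((tensorResolution P).obj X).X j) := by
    obtain ⟨n, f, hf⟩ := Module.Finite.exists_fin' R (P.complex.X j)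
    have : IsArtinian R (TensorProduct R (Fin n → R) X) :=
      ((TensorProduct.comm R _ _).trans
        (TensorProduct.piScalarRight R R X (Fin n))).isArtinian_iff.2
        inferInstance
    exact isArtinian_of_surjective _ (LinearMap.rTensor X f) (LinearMap.rTensor_surjective X hf)
  have : IsArtinian R (((tensorResolution P).obj X).cycles j) :=
    isArtinian_of_injective (((tensorResolution P).obj X).iCycles j).hom
      ((ModuleCat.mono_iff_injective _).1 inferInstance)
  exact isArtinian_of_surjective _ (((tensorResolution P).obj X).homologyπ j).hom
      ((ModuleCat.epi_iff_surjective _).1 inferInstance)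

section

variable {S : ShortComplex (ModuleCat.{u} R)} (hS : S.ShortExact)

/-- The connecting homomorphism of the long exact sequence of Tor. -/
def resTorδ (j : ℕ) : (resTor P (j + 1)).obj S.X₃ ⟶ (resTor P j).obj S.X₁ :=
  (shortExact_map_tensorResolution P hS).δ (j + 1) j rfl

include hS in
lemma exact_resTor_map_map (j : ℕ) :
    Function.Exact ((resTor P j).map S.f) ((resTor P j).map S.g) :=
  (ShortComplex.ShortExact.moduleCat_exact_iff_function_exact _).1
    ((shortExact_map_tensorResolution P hS).homology_exact₂ j)

lemma exact_resTor_δ_map (j : ℕ) :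
    Function.Exact (resTorδ P hS j) ((resTor P j).map S.f) :=
  (ShortComplex.ShortExact.moduleCat_exact_iff_function_exact _).1
    ((shortExact_map_tensorResolution P hS).homology_exact₁ (j + 1) j rfl)

lemma exact_resTor_map_δ (j : ℕ) :
    Function.Exact ((resTor P (j + 1)).map S.g) (resTorδ P hS j) :=
  (ShortComplex.ShortExact.moduleCat_exact_iff_function_exact _).1
    ((shortExact_map_tensorResolution P hS).homology_exact₃ (j + 1) j rfl)

include hS in
lemma resTor_zero_map_surjective : Function.Surjective ((resTor P 0).map S.g) := by
  have := (shortExact_map_tensorResolution P hS).epi_g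
  have : Epi ((S.map (tensorResolution P)).g.f 0) := inferInstance
  exact (ModuleCat.epi_iff_surjective _).1
    (HomologicalComplex.epi_homologyMap_of_epi_of_not_rel (S.map (tensorResolution P)).g 0
      (by simp))

end

/-- If `y` kills `N`, then multiplication by `y` on `X` induces zero on `Tor_j(N, X)`. -/
lemma resTor_map_smul_id_eq_zero (j : ℕ) (X : ModuleCat.{u} R) {y : R} (hy : ∀ x : N, y • x = 0) :
    (resTor P j).map (y • 𝟙 X) = 0 := by
  have h0 : y • 𝟙 N = 0 := by
    ext x
    exact hy x
  have comm : (y • 𝟙 P.complex : P.complex ⟶ P.complex).f 0 ≫ P.π.f 0 =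
      P.π.f 0 ≫ (0 : N ⟶ N) := by
    have : P.π.f 0 ≫ (y • 𝟙 N) = y • P.π.f 0 :=
      (Linear.comp_smul _ _ _ _ _ _).trans (congrArg (y • ·) (Category.comp_id (P.π.f 0)))
    rw [← h0, this]
    exact (Linear.smul_comp _ _ _ _ _ _).trans (congrArg (y • ·) (Category.id_comp _))
  -- Multiplication by `y` on `P` and the zero map both lift the zero endomorphism of `N`, so they
  -- agree on homology after tensoring. On `P ⊗ X`, the scalar may act on either factor.
  have h := ProjectiveResolution.isoLeftDerivedObj_hom_naturality (0 : N ⟶ N) P P (y • 𝟙 P.complex)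
    comm ((tensoringRight _).obj X) j
  rw [ProjectiveResolution.isoLeftDerivedObj_hom_naturality (0 : N ⟶ N) P P 0
    (zero_comp.trans comp_zero.symm) ((tensoringRight _).obj X) j, Functor.map_zero,
    comp_zero] at h
  have h1 : (resTor P j).map (y • 𝟙 X) = (((tensoringRight _).obj X).mapHomologicalComplex _ ⋙
      HomologicalComplex.homologyFunctor _ _ j).map (y • 𝟙 P.complex) := by
    refine congrArg (fun φ ↦ HomologicalComplex.homologyMap φ j) ?_
    ext1 i
    change P.complex.X i ◁ (y • 𝟙 X) = (y • 𝟙 (P.complex.X i)) ▷ X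
    simp
  exact h1.trans ((cancel_epi _).1 (h.symm.trans comp_zero.symm))

/-- The property that all modules `Tor_j(N, X)` are Artinian. -/
def HasArtinianTor (X : ModuleCat.{u} R) : Prop :=
  ∀ j, IsArtinian R ((resTor P j).obj X)

variable {P}

lemma HasArtinianTor.of_shortExact {S : ShortComplex (ModuleCat.{u} R)} (hS : S.ShortExact)
    (h₁ : HasArtinianTor P S.X₁) (h₃ : HasArtinianTor P S.X₃) : HasArtinianTor P S.X₂ := fun j ↦
  have := h₁ j
  have := h₃ j
  isArtinian_of_exact ((resTor P j).map S.f).hom ((resTor P j).map S.g).hom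
    (exact_resTor_map_map P hS j)

lemma HasArtinianTor.of_shortExact_right {S : ShortComplex (ModuleCat.{u} R)} (hS : S.ShortExact)
    (h₁ : HasArtinianTor P S.X₁) (h₂ : HasArtinianTor P S.X₂) : HasArtinianTor P S.X₃
  | 0 =>
    have := h₂ 0
    isArtinian_of_surjective _ ((resTor P 0).map S.g).hom (resTor_zero_map_surjective P hS)
  | j + 1 =>
    have := h₁ j
    have := h₂ (j + 1)
    isArtinian_of_exact ((resTor P (j + 1)).map S.g).hom (resTorδ P hS j).hom
      (exact_resTor_map_δ P hS j)

end ModuleCat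

namespace LinearMap

variable {R : Type u} [CommRing R] {X Y : Type u} [AddCommGroup X] [Module R X] [AddCommGroup Y]
  [Module R Y] (f : X →ₗ[R] Y)

/-- The short complex `0 ⟶ ker f ⟶ X ⟶ range f ⟶ 0`. -/
abbrev kerRangeShortComplex : ShortComplex (ModuleCat.{u} R) where
  X₁ := ModuleCat.of R (ker f)
  X₂ := ModuleCat.of R X
  X₃ := ModuleCat.of R (range f)
  f := ModuleCat.ofHom (ker f).subtype
  g := ModuleCat.ofHom f.rangeRestrict
  zero := by
    ext x
    exact congrArg Subtype.val (Subtype.ext x.2 : f.rangeRestrict x = 0)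

lemma kerRangeShortComplex_shortExact : f.kerRangeShortComplex.ShortExact := by
  refine ModuleCat.shortComplex_shortExact _ ?_ Subtype.val_injective f.surjective_rangeRestrict
  exact LinearMap.exact_iff.2 (f.ker_rangeRestrict.trans (Submodule.range_subtype _).symm)

/-- The short complex `0 ⟶ range f ⟶ Y ⟶ coker f ⟶ 0`. -/
abbrev rangeCokerShortComplex : ShortComplex (ModuleCat.{u} R) where
  X₁ := ModuleCat.of R (range f)
  X₂ := ModuleCat.of R Y
  X₃ := ModuleCat.of R (Y ⧸ range f)
  f := ModuleCat.ofHom (range f).subtype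
  g := ModuleCat.ofHom (range f).mkQ
  zero := by
    ext x
    exact (Submodule.Quotient.mk_eq_zero _).2 x.2

lemma rangeCokerShortComplex_shortExact : f.rangeCokerShortComplex.ShortExact :=
  ModuleCat.shortComplex_shortExact _ (LinearMap.exact_subtype_mkQ _) Subtype.val_injective
    (Submodule.mkQ_surjective _)

end LinearMap

namespace ModuleCat

variable {R : Type u} [CommRing R] {N : ModuleCat.{u} R} {P : ProjectiveResolution N}

/-- If the kernel and cokernel of `f : X → Y` are Artinian and all `Tor_j(N, X)` are Artinian,
then so are all `Tor_j(N, Y)`. -/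
lemma HasArtinianTor.of_linearMap (hP : ∀ j, Module.Finite R (P.complex.X j)) {X Y : Type u}
    [AddCommGroup X] [Module R X] [AddCommGroup Y] [Module R Y] (f : X →ₗ[R] Y)
    [IsArtinian R (LinearMap.ker f)] [IsArtinian R (Y ⧸ LinearMap.range f)]
    (h : HasArtinianTor P (ModuleCat.of R X)) : HasArtinianTor P (ModuleCat.of R Y) := by
  have h₁ : HasArtinianTor P (ModuleCat.of R (LinearMap.ker f)) := fun j ↦
    isArtinian_resTor_of_isArtinian P hP j _
  have h₂ : HasArtinianTor P (ModuleCat.of R (Y ⧸ LinearMap.range f)) := fun j ↦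
    isArtinian_resTor_of_isArtinian P hP j _
  have h₃ : HasArtinianTor P (ModuleCat.of R (LinearMap.range f)) :=
    HasArtinianTor.of_shortExact_right (S := f.kerRangeShortComplex)
      f.kerRangeShortComplex_shortExact h₁ h
  exact HasArtinianTor.of_shortExact (S := f.rangeCokerShortComplex)
    f.rangeCokerShortComplex_shortExact h₃ h₂

/-- If `y` kills `N` and the kernel and cokernel of multiplication by `y` on `X` are Artinian,
then all `Tor_j(N, X)` are Artinian. -/
lemma hasArtinianTor_of_smul (hP : ∀ j, Module.Finite R (P.complex.X j)) {X : Type u}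
    [AddCommGroup X] [Module R X] {y : R} (hy : ∀ x : N, y • x = 0)
    [IsArtinian R (LinearMap.ker (LinearMap.lsmul R X y))]
    [IsArtinian R (X ⧸ LinearMap.range (LinearMap.lsmul R X y))] :
    HasArtinianTor P (ModuleCat.of R X) := by
  intro j
  let f := LinearMap.lsmul R X y
  have h₁ := f.kerRangeShortComplex_shortExact
  have h₂ := f.rangeCokerShortComplex_shortExact
  have hcomp :
      f.kerRangeShortComplex.g ≫ f.rangeCokerShortComplex.f = y • 𝟙 (ModuleCat.of R X) := by
    ext x
    rfl
  have hzero (z : (resTor P j).obj (ModuleCat.of R X)) :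
      (resTor P j).map f.rangeCokerShortComplex.f ((resTor P j).map f.kerRangeShortComplex.g z) =
        0 := by
    have h := (congrArg (resTor P j).map hcomp).trans (resTor_map_smul_id_eq_zero P j _ hy)
    exact congr($(((resTor P j).map_comp _ _).symm.trans h) z)
  have := isArtinian_resTor_of_isArtinian P hP j (ModuleCat.of R (LinearMap.ker f))
  have := isArtinian_resTor_of_isArtinian P hP (j + 1) (ModuleCat.of R (X ⧸ LinearMap.range f))
  -- `Tor_j(N, X) → Tor_j(N, yX)` has image killed in `Tor_j(N, X)`, hence inside this range, a
  -- quotient of `Tor_(j+1)(N, X / yX)`; its kernel is a quotient of Tor of the kernel of `y`.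
  have : IsArtinian R (LinearMap.range (resTorδ P h₂ j).hom) :=
    isArtinian_of_surjective _ (resTorδ P h₂ j).hom.rangeRestrict
      (resTorδ P h₂ j).hom.surjective_rangeRestrict
  refine isArtinian_of_exact ((resTor P j).map f.kerRangeShortComplex.f).hom
    (LinearMap.codRestrict (LinearMap.range (resTorδ P h₂ j).hom)
      ((resTor P j).map f.kerRangeShortComplex.g).hom fun z ↦
        (exact_resTor_δ_map P h₂ j _).1 (hzero z)) fun z ↦ ?_
  exact Subtype.ext_iff.trans (exact_resTor_map_map P h₁ j z)

end ModuleCat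


/-! ### Limits along filtrations, and towers with constant cokernel. -/

namespace FormalLocalCohomology

open Opposite

variable {R : Type u} [CommRing R]

/-- The inverse system `M / U n` associated with a decreasing filtration `U` of `M`. -/
def filtrationTower {M : Type u} [AddCommGroup M] [Module R M] (U : ℕ → Submodule R M)
    (hU : Antitone U) : ℕᵒᵖ ⥤ ModuleCat.{u} R where
  obj n := ModuleCat.of R (M ⧸ U n.unop)
  map f := ModuleCat.ofHom (Submodule.factor (hU f.unop.le))
  map_id n := by
    ext x
    rfl
  map_comp f g := by
    ext x
    rfl

variable (J : Ideal R) (i : ℕ)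

section Cofinal

variable {M : Type u} [AddCommGroup M] [Module R M] {U V : ℕ → Submodule R M}
  (hU : Antitone U) (hV : Antitone V)

/-- The map on local cohomology induced by the projection `M / p → M / q` for `p ≤ q`. -/
def cohomologyFactor {p q : Submodule R M} (h : p ≤ q) :
    (localCohomology J i).obj (ModuleCat.of R (M ⧸ p)) →ₗ[R]
      (localCohomology J i).obj (ModuleCat.of R (M ⧸ q)) :=
  ((localCohomology J i).map (ModuleCat.ofHom (Submodule.factor h))).hom

lemma cohomologyFactor_comp {p q r : Submodule R M} (h : p ≤ q) (h' : q ≤ r)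
    (z : (localCohomology J i).obj (ModuleCat.of R (M ⧸ p))) :
    cohomologyFactor J i h' (cohomologyFactor J i h z) = cohomologyFactor J i (h.trans h') z := by
  have : ModuleCat.ofHom (Submodule.factor h) ≫ ModuleCat.ofHom (Submodule.factor h') =
      ModuleCat.ofHom (Submodule.factor (h.trans h')) := by
    ext x
    rfl
  exact congr($((((localCohomology J i).map_comp _ _).symm.trans
    (congrArg (localCohomology J i).map this))) z)

/-- The limit of the local cohomology modules `H^i_J(M / U n)`. -/
abbrev filtrationLimit : ModuleCat.{u} R :=
  limit (filtrationTower U hU ⋙ localCohomology J i)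

/-- The projection from the limit to `H^i_J(M / U n)`. -/
def filtrationLimitπ (n : ℕ) : filtrationLimit J i hU →ₗ[R]
    (localCohomology J i).obj (ModuleCat.of R (M ⧸ U n)) :=
  (limit.π (filtrationTower U hU ⋙ localCohomology J i) (op n)).hom

/-- The hypothesis compares submodules rather than indices, so both sides are compared at level `max
m n`. This makes the maps in `refineCone` independent of the chosen indices. -/
lemma cohomologyFactor_filtrationLimitπ {m n : ℕ} (h : U m ≤ U n) (z : filtrationLimit J i hU) :
    cohomologyFactor J i h (filtrationLimitπ J i hU m z) = filtrationLimitπ J i hU n z := by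
  have hw {m n : ℕ} (h : n ≤ m) (z : filtrationLimit J i hU) :
      cohomologyFactor J i (hU h) (filtrationLimitπ J i hU m z) = filtrationLimitπ J i hU n z :=
    congr($(limit.w (filtrationTower U hU ⋙ localCohomology J i) (homOfLE h).op) z)
  rw [← hw (le_max_left m n), ← hw (le_max_right m n), cohomologyFactor_comp]

lemma filtrationLimit_ext {z w : filtrationLimit J i hU}
    (h : ∀ n, filtrationLimitπ J i hU n z = filtrationLimitπ J i hU n w) : z = w :=
  ModuleCat.limit_hom_ext fun n ↦ h n.unop

variable (hUV : ∀ n, ∃ m, U m ≤ V n) (hVU : ∀ n, ∃ m, V m ≤ U n)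

/-- The cone defining the map of limits induced by a refinement of filtrations. -/
def refineCone : Cone (filtrationTower V hV ⋙ localCohomology J i) where
  pt := filtrationLimit J i hU
  π :=
    { app n := ModuleCat.ofHom (cohomologyFactor J i (hUV n.unop).choose_spec ∘ₗ
        filtrationLimitπ J i hU (hUV n.unop).choose)
      naturality m n f := by
        ext z
        have h := (hUV m.unop).choose_spec
        have h' := (hUV n.unop).choose_spec
        have hf := hV f.unop.le
        change cohomologyFactor J i h' (filtrationLimitπ J i hU _ z) =
          cohomologyFactor J i hf (cohomologyFactor J i h (filtrationLimitπ J i hU _ z))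
        rw [cohomologyFactor_comp,
          ← cohomologyFactor_filtrationLimitπ J i hU (hU (le_max_left (hUV n.unop).choose
            (hUV m.unop).choose)),
          ← cohomologyFactor_filtrationLimitπ J i hU (hU (le_max_right (hUV n.unop).choose
            (hUV m.unop).choose)), cohomologyFactor_comp, cohomologyFactor_comp] }

/-- The map of limits induced by a refinement of filtrations. -/
def refineMap : filtrationLimit J i hU →ₗ[R] filtrationLimit J i hV :=
  (limit.lift (filtrationTower V hV ⋙ localCohomology J i) (refineCone J i hU hV hUV)).hom

lemma filtrationLimitπ_refineMap {m n : ℕ} (h : U m ≤ V n) (z : filtrationLimit J i hU) :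
    filtrationLimitπ J i hV n (refineMap J i hU hV hUV z) =
      cohomologyFactor J i h (filtrationLimitπ J i hU m z) := by
  have h' := (hUV n).choose_spec
  have : filtrationLimitπ J i hV n (refineMap J i hU hV hUV z) =
      cohomologyFactor J i h' (filtrationLimitπ J i hU (hUV n).choose z) :=
    congr($(limit.lift_π (refineCone J i hU hV hUV) (op n)) z)
  rw [this, ← cohomologyFactor_filtrationLimitπ J i hU (hU (le_max_left (hUV n).choose m)),
    ← cohomologyFactor_filtrationLimitπ J i hU (hU (le_max_right (hUV n).choose m)),
    cohomologyFactor_comp, cohomologyFactor_comp]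

include hVU in
lemma refineMap_refineMap (z : filtrationLimit J i hU) :
    refineMap J i hV hU hVU (refineMap J i hU hV hUV z) = z := by
  refine filtrationLimit_ext J i hU fun n ↦ ?_
  obtain ⟨m, hm⟩ := hVU n
  obtain ⟨k, hk⟩ := hUV m
  rw [filtrationLimitπ_refineMap J i hV hU hVU hm, filtrationLimitπ_refineMap J i hU hV hUV hk,
    cohomologyFactor_comp, cohomologyFactor_filtrationLimitπ]

/-- Filtrations that refine each other have isomorphic limits. -/
def refineEquiv : filtrationLimit J i hU ≃ₗ[R] filtrationLimit J i hV where
  __ := refineMap J i hU hV hUV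
  invFun := refineMap J i hV hU hVU
  left_inv := refineMap_refineMap J i hU hV hUV hVU
  right_inv := refineMap_refineMap J i hV hU hVU hUV

end Cofinal

lemma isArtinian_limit_const (Z : ModuleCat.{u} R) [IsArtinian R ((localCohomology J i).obj Z)] :
    IsArtinian R (limit ((Functor.const ℕᵒᵖ).obj Z ⋙ localCohomology J i) : ModuleCat.{u} R) := by
  have : IsArtinian R (((Functor.const ℕᵒᵖ).obj Z ⋙ localCohomology J i).obj (op 0)) :=
    inferInstanceAs (IsArtinian R ((localCohomology J i).obj Z))
  have key (n : ℕᵒᵖ)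
      (z : (limit ((Functor.const ℕᵒᵖ).obj Z ⋙ localCohomology J i) : ModuleCat.{u} R)) :
      limit.π ((Functor.const ℕᵒᵖ).obj Z ⋙ localCohomology J i) n z =
        limit.π ((Functor.const ℕᵒᵖ).obj Z ⋙ localCohomology J i) (op 0) z := by
    refine Eq.trans ?_ congr($(limit.w ((Functor.const ℕᵒᵖ).obj Z ⋙ localCohomology J i)
      (homOfLE (Nat.zero_le n.unop)).op) z)
    exact congr($((localCohomology J i).map_id Z)
      (limit.π ((Functor.const ℕᵒᵖ).obj Z ⋙ localCohomology J i) n z)).symm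
  exact isArtinian_of_injective
    (limit.π ((Functor.const ℕᵒᵖ).obj Z ⋙ localCohomology J i) (op 0)).hom fun z w h ↦
      ModuleCat.limit_hom_ext fun n ↦ (key n z).trans (h.trans (key n w).symm)

section ConstantCokernel

variable {A B : ℕᵒᵖ ⥤ ModuleCat.{u} R} {Z : ModuleCat.{u} R} {α : A ⟶ B}
  {β : B ⟶ (Functor.const ℕᵒᵖ).obj Z} {w : ∀ n, α.app n ≫ β.app n = 0}
  (hS : ∀ n, (ShortComplex.mk (α.app n) (β.app n) (w n)).ShortExact)

/-- The connecting homomorphisms of an exact sequence of inverse systems with constant cokernel. -/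
def towerδ : (Functor.const ℕᵒᵖ).obj Z ⋙ localCohomology J i ⟶ A ⋙ localCohomology J (i + 1) where
  app n := ModuleCat.ofHom (localCohomology.δ J i (hS n))
  naturality m n f := by
    ext z
    exact (localCohomology.map_δ J i (hS m) (hS n)
      { τ₁ := A.map f
        τ₂ := B.map f
        τ₃ := 𝟙 Z
        comm₁₂ := α.naturality f
        comm₂₃ := β.naturality f } z).symm

variable (hA : ∀ n, localCohomology.HasArtinianLocalCohomology J (A.obj n))
  (hZ : localCohomology.HasArtinianLocalCohomology J Z)

include hS hZ in
-- In positive degree, the limit of the connecting maps is onto this kernel, and its source is the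
-- limit of a constant Artinian tower. In degree 0 every level is injective.
lemma isArtinian_ker_limMap : IsArtinian R
    (LinearMap.ker (limMap (Functor.whiskerRight α (localCohomology J i))).hom) := by
  cases i with
  | zero =>
    have : LinearMap.ker (limMap (Functor.whiskerRight α (localCohomology J 0))).hom = ⊥ := by
      rw [LinearMap.ker_eq_bot]
      refine fun z w h ↦ ModuleCat.limit_hom_ext fun n ↦
        localCohomology.map_injective_zero J (hS n) ?_
      have key := limMap_π (Functor.whiskerRight α (localCohomology J 0)) n
      have h' : limit.π (B ⋙ localCohomology J 0) n
            (limMap (Functor.whiskerRight α (localCohomology J 0)) z) =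
          limit.π (B ⋙ localCohomology J 0) n
            (limMap (Functor.whiskerRight α (localCohomology J 0)) w) :=
        congrArg (limit.π (B ⋙ localCohomology J 0) n) h
      have hz := congr($key z)
      have hw := congr($key w)
      exact hz.symm.trans (h'.trans hw)
    rw [this]
    infer_instance
  | succ i =>
    have (n : ℕᵒᵖ) : IsArtinian R (((Functor.const ℕᵒᵖ).obj Z ⋙ localCohomology J i).obj n) := hZ i
    have := hZ i
    have := isArtinian_limit_const J i Z
    have h := ModuleCat.exact_limMap (towerδ J i hS)
      (Functor.whiskerRight α (localCohomology J (i + 1)))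
      fun n ↦ localCohomology.exact_δ_map J i (hS n)
    have h' : LinearMap.ker (limMap (Functor.whiskerRight α (localCohomology J (i + 1)))).hom =
      LinearMap.range (limMap (towerδ J i hS)).hom := h.linearMap_ker_eq
    rw [h']
    exact isArtinian_of_surjective _ (limMap (towerδ J i hS)).hom.rangeRestrict
      (LinearMap.surjective_rangeRestrict _)

include hS hA hZ in
-- By exactness of the limit, the cokernel embeds in the limit of the constant tower on the
-- cohomology of `Z`.
lemma isArtinian_coker_limMap : IsArtinian R
    ((limit (B ⋙ localCohomology J i) : ModuleCat.{u} R) ⧸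
      LinearMap.range (limMap (Functor.whiskerRight α (localCohomology J i))).hom) := by
  have (n : ℕᵒᵖ) : IsArtinian R ((A ⋙ localCohomology J i).obj n) := hA n i
  have := hZ i
  have := isArtinian_limit_const J i Z
  have h := ModuleCat.exact_limMap (Functor.whiskerRight α (localCohomology J i))
    (Functor.whiskerRight β (localCohomology J i))
    fun n ↦ localCohomology.exact_map_map J i (hS n)
  have h' : LinearMap.ker (limMap (Functor.whiskerRight β (localCohomology J i))).hom =
      LinearMap.range (limMap (Functor.whiskerRight α (localCohomology J i))).hom :=
    h.linearMap_ker_eq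
  refine isArtinian_of_injective (Submodule.liftQ _
    (limMap (Functor.whiskerRight β (localCohomology J i))).hom h'.ge) ?_
  rw [← LinearMap.ker_eq_bot]
  exact Submodule.ker_liftQ_eq_bot _ _ _ h'.le

end ConstantCokernel

end FormalLocalCohomology

/-! ### The map of limits induced by an injection of modules. -/

namespace FormalLocalCohomology

open Opposite

variable {R : Type u} [CommRing R]

section Map

variable {N M : Type u} [AddCommGroup N] [Module R N] [AddCommGroup M] [Module R M]
  (f : N →ₗ[R] M) {W : ℕ → Submodule R N} (hW : Antitone W)

include hW in
lemma antitone_map : Antitone fun n ↦ (W n).map f :=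
  fun _ _ h ↦ Submodule.map_mono (hW h)

/-- The map `N / W n → M / f (W n)` of inverse systems induced by a linear map `f : N → M`. -/
def towerMap : filtrationTower W hW ⟶
    filtrationTower (fun n ↦ (W n).map f) (antitone_map f hW) where
  app n := ModuleCat.ofHom (Submodule.mapQ (W n.unop) ((W n.unop).map f) f
    (Submodule.le_comap_map f _))
  naturality m n g := by
    refine ModuleCat.hom_ext (Submodule.linearMap_qext _ ?_)
    rfl

/-- The projections of `M / f (W n)` onto the cokernel of `f`. -/
def towerToCoker : filtrationTower (fun n ↦ (W n).map f) (antitone_map f hW) ⟶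
    (Functor.const ℕᵒᵖ).obj (ModuleCat.of R (M ⧸ LinearMap.range f)) where
  app n := ModuleCat.ofHom (Submodule.factor (LinearMap.map_le_range (f := f)))
  naturality m n g := by
    refine ModuleCat.hom_ext (Submodule.linearMap_qext _ ?_)
    rfl

lemma towerMap_towerToCoker (n : ℕᵒᵖ) :
    (towerMap f hW).app n ≫ (towerToCoker f hW).app n = 0 := by
  refine ModuleCat.hom_ext (Submodule.linearMap_qext _ (LinearMap.ext fun x ↦ ?_))
  exact (Submodule.Quotient.mk_eq_zero _).2 ⟨x, rfl⟩

lemma shortExact_tower (hf : Function.Injective f) (n : ℕᵒᵖ) :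
    (ShortComplex.mk _ _ (towerMap_towerToCoker f hW n)).ShortExact where
  exact := by
    rw [ShortComplex.moduleCat_exact_iff]
    intro z hz
    obtain ⟨m, rfl⟩ := Submodule.Quotient.mk_surjective _ z
    obtain ⟨x, rfl⟩ := (Submodule.Quotient.mk_eq_zero _).1 hz
    exact ⟨Submodule.Quotient.mk x, rfl⟩
  mono_f := by
    rw [ModuleCat.mono_iff_injective]
    refine (injective_iff_map_eq_zero
      (Submodule.mapQ (W n.unop) ((W n.unop).map f) f (Submodule.le_comap_map f _))).2 fun z hz ↦ ?_
    obtain ⟨x, rfl⟩ := Submodule.Quotient.mk_surjective _ z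
    obtain ⟨y, hy, hxy⟩ := (Submodule.Quotient.mk_eq_zero _).1 hz
    exact (Submodule.Quotient.mk_eq_zero _).2 (hf hxy ▸ hy)
  epi_g := by
    rw [ModuleCat.epi_iff_surjective]
    exact Submodule.factor_surjective (LinearMap.map_le_range (f := f) (p := W n.unop))

variable (J : Ideal R) (i : ℕ)

/-- The map `lim H^i_J(N / W n) → lim H^i_J(M / f (W n))` induced by `f : N → M`. -/
def filtrationLimitMap : filtrationLimit J i hW →ₗ[R] filtrationLimit J i (antitone_map f hW) :=
  (limMap (Functor.whiskerRight (towerMap f hW) (localCohomology J i))).hom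

lemma filtrationLimitπ_filtrationLimitMap (n : ℕ) (z : filtrationLimit J i hW) :
    filtrationLimitπ J i (antitone_map f hW) n (filtrationLimitMap f hW J i z) =
      (localCohomology J i).map ((towerMap f hW).app (op n)) (filtrationLimitπ J i hW n z) :=
  congr($(limMap_π (Functor.whiskerRight (towerMap f hW) (localCohomology J i)) (op n)) z)

variable [IsNoetherianRing R] [J.IsMaximal] [Module.Finite R M]

lemma isArtinian_ker_filtrationLimitMap (hf : Function.Injective f) :
    IsArtinian R (LinearMap.ker (filtrationLimitMap f hW J i)) :=
  isArtinian_ker_limMap J i (shortExact_tower f hW hf)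
    (localCohomology.hasArtinianLocalCohomology _)

lemma isArtinian_coker_filtrationLimitMap [Module.Finite R N] (hf : Function.Injective f) :
    IsArtinian R (filtrationLimit J i (antitone_map f hW) ⧸
      LinearMap.range (filtrationLimitMap f hW J i)) :=
  isArtinian_coker_limMap J i (shortExact_tower f hW hf)
    (fun n ↦ localCohomology.hasArtinianLocalCohomology (N ⧸ W n.unop))
    (localCohomology.hasArtinianLocalCohomology _)

end Map

end FormalLocalCohomology

/-! ### Reduction to a module on which `y` is injective, and conclusion. -/

lemma isArtinian_coker_equiv_comp {R X Y Z : Type*} [CommRing R] [AddCommGroup X] [Module R X]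
    [AddCommGroup Y] [Module R Y] [AddCommGroup Z] [Module R Z] (f : X →ₗ[R] Y) (e : Y ≃ₗ[R] Z)
    [IsArtinian R (Y ⧸ LinearMap.range f)] :
    IsArtinian R (Z ⧸ LinearMap.range (e.toLinearMap ∘ₗ f)) :=
  isArtinian_of_linearEquiv (Submodule.Quotient.equiv (LinearMap.range f) _ e
    (LinearMap.range_comp f e.toLinearMap).symm)

lemma isArtinian_ker_equiv_comp {R X Y Z : Type*} [CommRing R] [AddCommGroup X] [Module R X]
    [AddCommGroup Y] [Module R Y] [AddCommGroup Z] [Module R Z] (f : X →ₗ[R] Y) (e : Y ≃ₗ[R] Z)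
    [IsArtinian R (LinearMap.ker f)] :
    IsArtinian R (LinearMap.ker (e.toLinearMap ∘ₗ f)) := by
  rwa [LinearEquiv.ker_comp]

/-- In a Noetherian module the `y`-power torsion is killed by a power of `y`. -/
lemma exists_forall_pow_smul_eq_zero {R M : Type*} [CommRing R] [AddCommGroup M] [Module R M]
    [IsNoetherian R M] (y : R) :
    ∃ s, ∀ m : M, y ^ (s + 1) • m = 0 → y ^ s • m = 0 := by
  let k : ℕ →o Submodule R M :=
    { toFun n := LinearMap.ker (LinearMap.lsmul R M (y ^ n))
      monotone' m n h x hx := by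
        have hx : y ^ m • x = 0 := hx
        obtain ⟨c, rfl⟩ := Nat.exists_eq_add_of_le' h
        change y ^ (c + m) • x = 0
        rw [pow_add, mul_smul, hx, smul_zero] }
  obtain ⟨s, hs⟩ := monotone_stabilizes_iff_noetherian.2 ‹_› k
  refine ⟨s, fun m hm ↦ ?_⟩
  have : m ∈ k (s + 1) := hm
  rwa [← hs (s + 1) (Nat.le_succ s)] at this

lemma Ideal.IsPrincipalUpToRadical.exists_mem_pow_le {R : Type u} [CommRing R] [IsNoetherianRing R]
    {a : Ideal R} (ha : a.IsPrincipalUpToRadical) :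
    ∃ y ∈ a, ∃ c, a ^ c ≤ Ideal.span {y} := by
  obtain ⟨x, hx⟩ := ha
  obtain ⟨k, hk⟩ : x ∈ a.radical := hx ▸ Ideal.le_radical (Ideal.mem_span_singleton_self x)
  refine ⟨x ^ k, hk, Ideal.exists_pow_le_of_le_radical_of_fg ?_ (IsNoetherian.noetherian a)⟩
  refine (Ideal.le_radical.trans hx.le).trans (Ideal.radical_le_radical_iff.2 ?_)
  rw [Ideal.span_singleton_le_iff_mem]
  exact ⟨k, Ideal.mem_span_singleton_self _⟩

namespace FormalLocalCohomology

open Opposite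

variable {R : Type u} [CommRing R]

section Smul

variable {N : Type u} [AddCommGroup N] [Module R N] {W : ℕ → Submodule R N} (hW : Antitone W)
  (J : Ideal R) (i : ℕ) (y : R) (hy : ∀ n, ∃ m, W m ≤ (W n).map (LinearMap.lsmul R N y))

lemma map_lsmul_le (p : Submodule R N) : p.map (LinearMap.lsmul R N y) ≤ p := by
  rintro _ ⟨x, hx, rfl⟩
  exact p.smul_mem y hx

/-- The limits along the filtrations `y • W n` and `W n` agree if these refine each other. -/
def smulRefineEquiv :
    filtrationLimit J i (antitone_map (LinearMap.lsmul R N y) hW) ≃ₗ[R] filtrationLimit J i hW :=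
  refineEquiv J i (antitone_map (LinearMap.lsmul R N y) hW) hW (fun n ↦ ⟨n, map_lsmul_le y _⟩) hy

/-- At each level, the map `N / W n → N / y W n` induced by `y`, followed by the projection to `N /
W n`, is multiplication by `y`. Thus the results on injections of modules apply to the scalar `y` on
the limit. -/
lemma smulRefineEquiv_filtrationLimitMap :
    (smulRefineEquiv hW J i y hy).toLinearMap ∘ₗ
      filtrationLimitMap (LinearMap.lsmul R N y) hW J i =
        LinearMap.lsmul R (filtrationLimit J i hW) y := by
  ext z
  refine filtrationLimit_ext J i hW fun n ↦ ?_
  refine (filtrationLimitπ_refineMap J i (antitone_map (LinearMap.lsmul R N y) hW) hW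
    (fun n ↦ ⟨n, map_lsmul_le y _⟩) (map_lsmul_le y (W n)) _).trans ?_
  refine (congrArg (cohomologyFactor J i (map_lsmul_le y (W n)))
    (filtrationLimitπ_filtrationLimitMap (LinearMap.lsmul R N y) hW J i n z)).trans ?_
  have h : (towerMap (LinearMap.lsmul R N y) hW).app (op n) ≫
      ModuleCat.ofHom (Submodule.factor (map_lsmul_le y (W n))) =
        y • 𝟙 (ModuleCat.of R (N ⧸ W n)) :=
    ModuleCat.hom_ext (Submodule.linearMap_qext _ rfl)
  refine (congr($(((localCohomology J i).map_comp _ _).symm.trans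
    (congrArg (localCohomology J i).map h)) (filtrationLimitπ J i hW n z))).trans ?_
  refine (localCohomology.map_smul_apply J i y _ _).trans ?_
  refine Eq.trans ?_ (map_smul (filtrationLimitπ J i hW n) y z).symm
  exact congrArg (y • ·) congr($((localCohomology J i).map_id _) (filtrationLimitπ J i hW n z))

variable [IsNoetherianRing R] [J.IsMaximal] [Module.Finite R N]
  (hinj : Function.Injective (LinearMap.lsmul R N y))

include hy hinj

lemma isArtinian_ker_lsmul_filtrationLimit :
    IsArtinian R (LinearMap.ker (LinearMap.lsmul R (filtrationLimit J i hW) y)) := by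
  have := isArtinian_ker_filtrationLimitMap (LinearMap.lsmul R N y) hW J i hinj
  rw [← smulRefineEquiv_filtrationLimitMap hW J i y hy]
  exact isArtinian_ker_equiv_comp _ _

lemma isArtinian_coker_lsmul_filtrationLimit :
    IsArtinian R (filtrationLimit J i hW ⧸
      LinearMap.range (LinearMap.lsmul R (filtrationLimit J i hW) y)) := by
  have := isArtinian_coker_filtrationLimitMap (LinearMap.lsmul R N y) hW J i hinj
  rw [← smulRefineEquiv_filtrationLimitMap hW J i y hy]
  exact isArtinian_coker_equiv_comp _ _

end Smul

lemma antitone_range_lsmul_pow (N : Type u) [AddCommGroup N] [Module R N] (y : R) :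
    Antitone fun n ↦ LinearMap.range (LinearMap.lsmul R N (y ^ n)) := by
  rintro m n h _ ⟨x, rfl⟩
  obtain ⟨c, rfl⟩ := Nat.exists_eq_add_of_le h
  exact ⟨y ^ c • x, by simp [pow_add, mul_smul, smul_comm (y ^ m)]⟩

lemma antitone_pow_smul_top (a : Ideal R) (M : Type u) [AddCommGroup M] [Module R M] :
    Antitone fun n ↦ (a ^ n • ⊤ : Submodule R M) :=
  fun _ _ h ↦ Submodule.smul_mono_left (Ideal.pow_le_pow_right h)

lemma hasArtinianTor_formalLocalCohomology [IsNoetherianRing R] [IsLocalRing R] {a : Ideal R}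
    (ha : a.IsPrincipalUpToRadical) (M : Type u) [AddCommGroup M] [Module R M] [Module.Finite R M]
    (i : ℕ) (P : ProjectiveResolution (ModuleCat.of R (R ⧸ a)))
    (hP : ∀ j, Module.Finite R (P.complex.X j)) :
    ModuleCat.HasArtinianTor P (formalLocalCohomology a i (ModuleCat.of R M)) := by
  obtain ⟨y, hya, c, hc⟩ := ha.exists_mem_pow_le
  obtain ⟨s, hs⟩ := exists_forall_pow_smul_eq_zero (M := M) y
  -- By the choice of `s`, `y` is injective on `y ^ s M`: if `y ^ (s + 1) m = 0` then `y ^ s m = 0`.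
  let N := LinearMap.range (LinearMap.lsmul R M (y ^ s))
  let W (n : ℕ) := LinearMap.range (LinearMap.lsmul R N (y ^ n))
  have hW : Antitone W := antitone_range_lsmul_pow N y
  have hinj : Function.Injective (LinearMap.lsmul R N y) := by
    refine (injective_iff_map_eq_zero _).2 ?_
    rintro ⟨_, m, rfl⟩ h
    have h : y • y ^ s • m = 0 := congrArg Subtype.val h
    exact Subtype.ext (hs m (by rw [pow_succ', mul_smul, h]))
  have hWy (n : ℕ) : ∃ m, W m ≤ (W n).map (LinearMap.lsmul R N y) := by
    refine ⟨n + 1, ?_⟩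
    rintro _ ⟨x, rfl⟩
    exact ⟨_, ⟨x, rfl⟩, by simp [pow_succ, mul_smul]⟩
  have h₁ (n : ℕ) : ∃ m, (W m).map N.subtype ≤ (a ^ n • ⊤ : Submodule R M) := by
    refine ⟨n, ?_⟩
    rintro _ ⟨_, ⟨x, rfl⟩, rfl⟩
    exact Submodule.smul_mem_smul (Ideal.pow_mem_pow hya n) trivial
  have h₂ (n : ℕ) : ∃ m, (a ^ m • ⊤ : Submodule R M) ≤ (W n).map N.subtype := by
    -- Here `a ^ (c * (n + s)) ≤ (y ^ (n + s))`, and `y ^ (n + s) M = y ^ n N` is the image of `W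
    -- n`.
    refine ⟨c * (n + s), ?_⟩
    rw [pow_mul, Submodule.smul_le]
    intro r hr m _
    have hr : r ∈ Ideal.span {y ^ (n + s)} := by
      rw [← Ideal.span_singleton_pow]
      exact Ideal.pow_right_mono hc _ hr
    obtain ⟨t, rfl⟩ := Ideal.mem_span_singleton'.1 hr
    exact ⟨_, ⟨⟨_, ⟨t • m, rfl⟩⟩, rfl⟩, by simp [pow_add, mul_smul, smul_comm t]⟩
  let J := IsLocalRing.maximalIdeal R
  have := isArtinian_ker_lsmul_filtrationLimit hW J i y hWy hinj
  have := isArtinian_coker_lsmul_filtrationLimit hW J i y hWy hinj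
  have hF : ModuleCat.HasArtinianTor P (filtrationLimit J i hW) := by
    refine ModuleCat.hasArtinianTor_of_smul hP (X := filtrationLimit J i hW) (y := y) fun x ↦ ?_
    obtain ⟨x, rfl⟩ := Ideal.Quotient.mk_surjective x
    exact Ideal.Quotient.eq_zero_iff_mem.2 (a.mul_mem_right x hya)
  have := isArtinian_ker_filtrationLimitMap N.subtype hW J i N.injective_subtype
  have := isArtinian_coker_filtrationLimitMap N.subtype hW J i N.injective_subtype
  -- The filtration of `M` by the images of `W n` is cofinal with the `a`-adic one, so the target of
  -- the map induced by `N → M` becomes the formal local cohomology of `M`.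
  let e := refineEquiv J i (antitone_map N.subtype hW) (antitone_pow_smul_top a M) h₁ h₂
  have := isArtinian_ker_equiv_comp (filtrationLimitMap N.subtype hW J i) e
  have := isArtinian_coker_equiv_comp (filtrationLimitMap N.subtype hW J i) e
  exact ModuleCat.HasArtinianTor.of_linearMap hP (X := filtrationLimit J i hW)
    (Y := filtrationLimit J i (antitone_pow_smul_top a M))
    (e.toLinearMap ∘ₗ filtrationLimitMap N.subtype hW J i) hF

end FormalLocalCohomology
end

theorem theorem3p2 {R : Type u} [CommRing R] [IsNoetherianRing R] [IsLocalRing R]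
    (a : Ideal R) (ha : a.IsPrincipalUpToRadical)
    (M : Type u) [AddCommGroup M] [Module R M] [Module.Finite R M] (i j : ℕ) :
    IsArtinian R
      (torModule j (ModuleCat.of R (R ⧸ a)) (formalLocalCohomology a i (ModuleCat.of R M))) := by
  obtain ⟨P, hP⟩ := FGModuleCat.exists_finite_projectiveResolution (R := R) (R ⧸ a)
  have := FormalLocalCohomology.hasArtinianTor_formalLocalCohomology ha M i P hP j
  exact isArtinian_of_linearEquiv (ModuleCat.torModuleIso P j _).symm.toLinearEquiv
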